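/- For $\alpha>-1/2$ and $n\ge 0$ let $$L_n^{(\alpha)}(x)=\sum_{k=0}^n\binom{n+\alpha}{n-k}\frac{(-x)^k}{k!},\qquad \mathcal L_n^\alpha(x)=\sqrt{\frac{\Gamma(n+1)}{\Gamma(n+\alpha+1)}}\;e^{-x/2}x^{\alpha/2}L_n^{(\alpha)}(x)\quad(x>0)$$ be the Laguerre polynomials and the normalized Laguerre functions. **Theorem.** Let $\alpha>-1/2$, $4<p<\infty$ and $0<\delta<\frac14-\frac1p$. Then there is a real-valued function $f\in L^p(0,\infty)$ (with respect to Lebesgue measure) such that $f\,\mathcal L_n^\alpha$ is integrable on $(0,\infty)$ for every $n\ge0$ and, with $c_n(f)=\int_0^\infty f(x)\mathcal L_n^\alpha(x)\,dx$, the Laguerre expansion $\sum_{n=0}^\infty c_n(f)\mathcal L_n^\alpha(x)$ has the following properties. 1. For almost every $x\in(0,\infty)$ its Cesàro means of order $\delta$, $$\sigma_N^\delta f(x)=\sum_{n=0}^N\frac{A_{N-n}^\delta}{A_N^\delta}\,c_n(f)\mathcal L_n^\alpha(x),\qquad A_n^\delta=\binom{n+\delta}{n},$$ have no finite limit as $N\to\infty$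 through the natural numbers. 2. For almost every $x\in(0,\infty)$ its Riesz means of order $\delta$, $$S_r^\delta f(x)=\sum_{0\le n<r}\Bigl(1-\frac nr\Bigr)^\delta c_n(f)\mathcal L_n^\alpha(x),$$ have no finite limit as $r\to\infty$ through the positive real numbers. -/

import Mathlib

open MeasureTheory Filter Topology Set

noncomputable section

/-- The Laguerre polynomial `L_n^{(α)}(x) = ∑_{k=0}^n binom(n+α, n-k) (-x)^k / k!`,
where `binom` is the generalized binomial coefficient. -/
def laguerrePoly (α : ℝ) (n : ℕ) (x : ℝ) : ℝ :=
  ∑ k ∈ Finset.range (n + 1), Ring.choose ((n : ℝ) + α) (n - k) * (-x) ^ k / (k.factorial : ℝ)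

/-- The normalized Laguerre function
`𝓛_n^α(x) = (Γ(n+1)/Γ(n+α+1))^{1/2} e^{-x/2} x^{α/2} L_n^{(α)}(x)`. -/
def laguerreFun (α : ℝ) (n : ℕ) (x : ℝ) : ℝ :=
  √(Real.Gamma ((n : ℝ) + 1) / Real.Gamma ((n : ℝ) + α + 1)) *
    Real.exp (-x / 2) * x ^ (α / 2) * laguerrePoly α n x

/-- The coefficient `c_n(f) = ∫_0^∞ f(x) 𝓛_n^α(x) dx`. -/
def laguerreCoeff (α : ℝ) (f : ℝ → ℝ) (n : ℕ) : ℝ :=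
  ∫ x in Ioi (0 : ℝ), f x * laguerreFun α n x

/-- The `n`-th term `c_n(f) 𝓛_n^α(x)` of the Laguerre expansion of `f` at `x`. -/
def laguerreTerm (α : ℝ) (f : ℝ → ℝ) (x : ℝ) (n : ℕ) : ℝ :=
  laguerreCoeff α f n * laguerreFun α n x

/-- The number `A_n^δ = binom(n+δ, n)`. -/
def cesaroNumber (δ : ℝ) (n : ℕ) : ℝ :=
  Ring.choose ((n : ℝ) + δ) n

/-- The Cesàro means `∑_{n=0}^N (A_{N-n}^δ / A_N^δ) a_n` of order `δ` of the series `∑ a_n`. -/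
def cesaroMean (δ : ℝ) (a : ℕ → ℝ) (N : ℕ) : ℝ :=
  ∑ n ∈ Finset.range (N + 1), cesaroNumber δ (N - n) / cesaroNumber δ N * a n

/-- The Riesz means `∑_{0 ≤ n < r} (1 - n/r)^δ a_n` of order `δ` of the series `∑ a_n`
(for a natural number `n`, one has `n < ⌈r⌉₊` if and only if `n < r`). -/
def rieszMean (δ : ℝ) (a : ℕ → ℝ) (r : ℝ) : ℝ :=
  ∑ n ∈ Finset.range ⌈r⌉₊, (1 - (n : ℝ) / r) ^ δ * a n

end

/-!
The proof plays two sizes of the Laguerre functions against each other: on compact subsets of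
`(0, ∞)` the function `𝓛_n^α` has size `n^{-1/4}`, while its norm as a functional on `L^p(0, ∞)`,
`p > 4`, is at least of order `n^{1/2 - 1/p}`.

* Tauberian step. If the Cesàro or Riesz means of order `δ ∈ (0, 1)` of `∑ a_n` converge, then
  `a_n = O(n^δ)`. Both kinds of means, the Riesz means being taken at integers only, are
  convolutions with weights whose increments are positive, decreasing and log-convex, so Kaluza's
  theorem on reciprocal power series bounds the inverse convolution in `ℓ¹`
  (`abs_le_of_abs_convolution_le`).
* Size of the Laguerre functions. The function `u(t) = √t 𝓛_n^α(t²)` solves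
  `u'' = -(ν² - t² - (α² - 1/4) / t²) u` with `ν² = 4 n + 2 α + 2`. The energy
  `u'² + (ν² - t²) u²` varies by a bounded factor only between `t = 1 / (2 ν)`, where the Laguerre
  polynomial is comparable with its value `binom(n + α, n)` at the origin, and `t = ν / 2`
  (`energy_comparable`). Hence the amplitude of `u` is at least a multiple of `ν^{-1/2}` on this
  whole range, and `u` is small compared with its amplitude only on sets of small relative
  measure (`exists_volume_laguerreFun_le`). No asymptotic formula is needed.
* Large coefficients. On `ν / 4 ≤ t ≤ ν / 2` the lower bound shows that the norm of the functional
  `f ↦ c_n(f)` on `L^p` is at least of order `n^{1/2 - 1/p}`. As `δ + 1/4 < 1/2 - 1/p`, the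
  Banach–Steinhaus theorem gives an `f` with `c_n(f) ≠ O(n^{δ + 1/4})`
  (`exists_memLp_laguerreCoeff_unbounded`).
* Divergence. If `c_n(f) 𝓛_n^α(x) = O(n^δ)` held on a set of positive measure, then the lower
  bound on a compact interval would give `c_n(f) = O(n^{δ + 1/4})`
  (`ae_not_exists_abs_mul_laguerreFun_le`). So the terms fail to be `O(n^δ)` almost everywhere, and
  by the Tauberian step neither kind of means converges there.
-/

/-! ### A Tauberian bound for summation methods with log-convex weights -/

/-- Kaluza's theorem: the reciprocal of a power series with positive log-convex coefficients has
nonpositive coefficients after the constant one. -/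
lemma kaluza_coeff_inv_nonpos {d : ℕ → ℝ} (h0 : d 0 = 1) (hpos : ∀ n, 0 < d n)
    (hlog : ∀ n, d (n + 1) ^ 2 ≤ d n * d (n + 2)) (n : ℕ) :
    PowerSeries.coeff (n + 1) (PowerSeries.mk d)⁻¹ ≤ 0 := by
  set D := PowerSeries.mk d with hD
  have hDc : PowerSeries.constantCoeff D ≠ 0 := by
    simp [hD, ← PowerSeries.coeff_zero_eq_constantCoeff_apply, h0]
  have hg0 : PowerSeries.coeff 0 D⁻¹ = 1 := by
    rw [PowerSeries.coeff_zero_eq_constantCoeff_apply, PowerSeries.constantCoeff_inv,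
      ← PowerSeries.coeff_zero_eq_constantCoeff_apply, hD, PowerSeries.coeff_mk, h0, inv_one]
  have hconv : ∀ m, ∑ k ∈ Finset.range (m + 2), PowerSeries.coeff k D⁻¹ * d (m + 1 - k) = 0 := by
    intro m
    have h1 : PowerSeries.coeff (m + 1) (D⁻¹ * D) = 0 := by
      rw [PowerSeries.inv_mul_cancel _ hDc]
      simp [PowerSeries.coeff_one]
    rw [PowerSeries.coeff_mul, Finset.Nat.sum_antidiagonal_eq_sum_range_succ_mk] at h1
    simpa [hD] using h1
  -- the ratios of consecutive coefficients increase
  have hratio : ∀ m k, d (m + 1) * d (m + k) ≤ d (m + k + 1) * d m := by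
    intro m k
    induction k with
    | zero => exact le_rfl
    | succ k ih =>
      have h1 := hlog (m + k)
      have h2 := hpos (m + k)
      have h3 := hpos (m + k + 1)
      have h4 := hpos m
      have h5 := hpos (m + 1)
      have h6 : d (m + 1) * d (m + k + 1) * d (m + k) ≤ d (m + k + 2) * d m * d (m + k) := by
        calc d (m + 1) * d (m + k + 1) * d (m + k)
            = (d (m + 1) * d (m + k)) * d (m + k + 1) := by ring
          _ ≤ (d (m + k + 1) * d m) * d (m + k + 1) := by gcongr
          _ = d (m + k + 1) ^ 2 * d m := by ring
          _ ≤ (d (m + k) * d (m + k + 2)) * d m := by gcongr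
          _ = _ := by ring
      exact le_of_mul_le_mul_right h6 h2
  induction n using Nat.strong_induction_on with
  | _ n ih =>
    rcases Nat.eq_zero_or_pos n with rfl | hn
    · have h := hconv 0
      rw [Finset.sum_range_succ, Finset.sum_range_one, hg0] at h
      simp only [Nat.sub_self, h0, zero_add, Nat.sub_zero] at h ⊢
      linarith [hpos 1]
    · obtain ⟨m, rfl⟩ : ∃ m, n = m + 1 := ⟨n - 1, by omega⟩
      have hA := hconv (m + 1)
      have hB := hconv m
      rw [Finset.sum_range_succ, Finset.sum_range_succ', hg0] at hA
      rw [Finset.sum_range_succ', hg0] at hB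
      simp only [Nat.sub_self, h0, Nat.sub_zero, mul_one, one_mul] at hA hB
      -- Eliminating the leading term between two consecutive identities leaves a sum of products
      -- of two nonpositive factors.
      have key : 0 ≤ ∑ k ∈ Finset.range (m + 1), PowerSeries.coeff (k + 1) D⁻¹ *
          (d (m + 1 + 1 - (k + 1)) * d (m + 1) - d (m + 1 - (k + 1)) * d (m + 1 + 1)) := by
        refine Finset.sum_nonneg fun k hk => ?_
        have hk' : k < m + 1 := Finset.mem_range.mp hk
        refine mul_nonneg_of_nonpos_of_nonpos (ih k hk') ?_
        have h7 := hratio (m - k) (k + 1)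
        have e1 : m + 1 + 1 - (k + 1) = m - k + 1 := by omega
        have e2 : m + 1 - (k + 1) = m - k := by omega
        have e3 : m - k + (k + 1) = m + 1 := by omega
        rw [e3] at h7
        rw [e1, e2]
        linarith
      have hsum : ∑ k ∈ Finset.range (m + 1), PowerSeries.coeff (k + 1) D⁻¹ *
          (d (m + 1 + 1 - (k + 1)) * d (m + 1) - d (m + 1 - (k + 1)) * d (m + 1 + 1)) =
          (∑ k ∈ Finset.range (m + 1), PowerSeries.coeff (k + 1) D⁻¹ *
            d (m + 1 + 1 - (k + 1))) * d (m + 1) -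
          (∑ k ∈ Finset.range (m + 1), PowerSeries.coeff (k + 1) D⁻¹ *
            d (m + 1 - (k + 1))) * d (m + 1 + 1) := by
        rw [Finset.sum_mul, Finset.sum_mul, ← Finset.sum_sub_distrib]
        exact Finset.sum_congr rfl fun k _ => by ring
      rw [hsum, eq_neg_of_add_eq_zero_left hB] at key
      have h8 : PowerSeries.coeff (m + 1 + 1) D⁻¹ * d (m + 1) ≤ 0 := by
        have h9 : (∑ k ∈ Finset.range (m + 1), PowerSeries.coeff (k + 1) D⁻¹ *
            d (m + 1 + 1 - (k + 1))) =
            -d (m + 1 + 1) - PowerSeries.coeff (m + 1 + 1) D⁻¹ := by linarith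
        rw [h9] at key
        linarith
      exact nonpos_of_mul_nonpos_left h8 (hpos _)

/-- The coefficients of the reciprocal in Kaluza's theorem are absolutely summable, with sum at
most `2`, when the original coefficients decrease. -/
lemma kaluza_sum_abs_coeff_inv_le {d : ℕ → ℝ} (h0 : d 0 = 1) (hpos : ∀ n, 0 < d n)
    (hanti : Antitone d) (hlog : ∀ n, d (n + 1) ^ 2 ≤ d n * d (n + 2)) (n : ℕ) :
    ∑ k ∈ Finset.range (n + 1), |PowerSeries.coeff k (PowerSeries.mk d)⁻¹| ≤ 2 := by
  have hneg := kaluza_coeff_inv_nonpos h0 hpos hlog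
  set D := PowerSeries.mk d with hD
  have hDc : PowerSeries.constantCoeff D ≠ 0 := by
    simp [hD, ← PowerSeries.coeff_zero_eq_constantCoeff_apply, h0]
  have hg0 : PowerSeries.coeff 0 D⁻¹ = 1 := by
    rw [PowerSeries.coeff_zero_eq_constantCoeff_apply, PowerSeries.constantCoeff_inv,
      ← PowerSeries.coeff_zero_eq_constantCoeff_apply, hD, PowerSeries.coeff_mk, h0, inv_one]
  rcases Nat.eq_zero_or_pos n with rfl | hn
  · rw [Finset.sum_range_one, hg0]; norm_num
  obtain ⟨m, rfl⟩ : ∃ m, n = m + 1 := ⟨n - 1, by omega⟩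
  have h1 : PowerSeries.coeff (m + 1) (D⁻¹ * D) = 0 := by
    rw [PowerSeries.inv_mul_cancel _ hDc]
    simp [PowerSeries.coeff_one]
  rw [PowerSeries.coeff_mul, Finset.Nat.sum_antidiagonal_eq_sum_range_succ_mk,
    Finset.sum_range_succ', hg0] at h1
  simp only [hD, PowerSeries.coeff_mk, Nat.sub_zero, one_mul] at h1
  rw [← hD] at h1
  rw [Finset.sum_range_succ', hg0, abs_one]
  have h2 : (∑ k ∈ Finset.range (m + 1), |PowerSeries.coeff (k + 1) D⁻¹|) * d (m + 1) ≤
      1 * d (m + 1) := by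
    rw [Finset.sum_mul, one_mul]
    have h3 : ∑ k ∈ Finset.range (m + 1), |PowerSeries.coeff (k + 1) D⁻¹| * d (m + 1) ≤
        ∑ k ∈ Finset.range (m + 1), -(PowerSeries.coeff (k + 1) D⁻¹ * d (m + 1 - (k + 1))) := by
      refine Finset.sum_le_sum fun k _ => ?_
      rw [abs_of_nonpos (hneg k), ← neg_mul]
      exact mul_le_mul_of_nonneg_left (hanti (Nat.sub_le _ _)) (neg_nonneg.mpr (hneg k))
    rw [Finset.sum_neg_distrib] at h3
    linarith
  linarith [le_of_mul_le_mul_right h2 (hpos _)]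

/-- If the weights `b` have positive, decreasing, log-convex increments `d`, then a bound for the
means `∑ b_{N-k} a_k` passes to the terms `a_N`: with `z` the formal variable,
`∑ a_n zⁿ = (∑ d_n zⁿ)⁻¹ (1 - z) ∑ S_n zⁿ`, and Kaluza's theorem bounds the inverse in `ℓ¹`. -/
lemma abs_le_of_abs_convolution_le {b d a M : ℕ → ℝ} (h0 : d 0 = 1) (hpos : ∀ n, 0 < d n)
    (hanti : Antitone d) (hlog : ∀ n, d (n + 1) ^ 2 ≤ d n * d (n + 2)) (hb0 : b 0 = 1)
    (hb : ∀ n, b (n + 1) = b n + d (n + 1)) (hM : Monotone M)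
    (hS : ∀ N, |∑ k ∈ Finset.range (N + 1), b (N - k) * a k| ≤ M N) (N : ℕ) :
    |a N| ≤ 4 * M N := by
  set D := PowerSeries.mk d with hD
  have hDc : PowerSeries.constantCoeff D ≠ 0 := by
    simp [hD, ← PowerSeries.coeff_zero_eq_constantCoeff_apply, h0]
  set S : ℕ → ℝ := fun N => ∑ k ∈ Finset.range (N + 1), b (N - k) * a k with hSdef
  set T : ℕ → ℝ := fun N => ∑ k ∈ Finset.range (N + 1), a k * d (N - k) with hT
  have hM0 : ∀ N, 0 ≤ M N := fun N => (abs_nonneg _).trans (hS N)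
  have hTS : ∀ N, T (N + 1) = S (N + 1) - S N := by
    intro N
    simp only [hT, hSdef]
    rw [Finset.sum_range_succ, Finset.sum_range_succ (n := N + 1), add_sub_right_comm,
      ← Finset.sum_sub_distrib]
    congr 1
    · refine Finset.sum_congr rfl fun k hk => ?_
      have hk' : k < N + 1 := Finset.mem_range.mp hk
      have e : N + 1 - k = N - k + 1 := by omega
      rw [e, hb]; ring
    · simp [h0, hb0]
  have hTM : ∀ j ≤ N, |T j| ≤ 2 * M N := by
    intro j hj
    rcases Nat.eq_zero_or_pos j with rfl | hj0
    · have h1 : T 0 = S 0 := by simp [hT, hSdef, h0, hb0]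
      rw [h1]
      linarith [hS 0, hM hj, hM0 N]
    · obtain ⟨i, rfl⟩ : ∃ i, j = i + 1 := ⟨j - 1, by omega⟩
      rw [hTS]
      have h2 := abs_sub (S (i + 1)) (S i)
      linarith [hS (i + 1), hS i, hM hj, hM (show i ≤ N by omega)]
  have hser : PowerSeries.mk a = D⁻¹ * PowerSeries.mk T := by
    have h1 : PowerSeries.mk T = D * PowerSeries.mk a := by
      ext n
      rw [mul_comm, PowerSeries.coeff_mul, Finset.Nat.sum_antidiagonal_eq_sum_range_succ_mk]
      simp [hT, hD]
    rw [h1, ← mul_assoc, PowerSeries.inv_mul_cancel _ hDc, one_mul]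
  have haN : a N = ∑ k ∈ Finset.range (N + 1), PowerSeries.coeff k D⁻¹ * T (N - k) := by
    have h1 := congrArg (PowerSeries.coeff N) hser
    rw [PowerSeries.coeff_mul, Finset.Nat.sum_antidiagonal_eq_sum_range_succ_mk] at h1
    simpa using h1
  rw [haN]
  calc |∑ k ∈ Finset.range (N + 1), PowerSeries.coeff k D⁻¹ * T (N - k)|
      ≤ ∑ k ∈ Finset.range (N + 1), |PowerSeries.coeff k D⁻¹ * T (N - k)| :=
        Finset.abs_sum_le_sum_abs _ _
    _ ≤ ∑ k ∈ Finset.range (N + 1), |PowerSeries.coeff k D⁻¹| * (2 * M N) := by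
        refine Finset.sum_le_sum fun k _ => ?_
        rw [abs_mul]
        exact mul_le_mul_of_nonneg_left (hTM _ (Nat.sub_le _ _)) (abs_nonneg _)
    _ = (∑ k ∈ Finset.range (N + 1), |PowerSeries.coeff k D⁻¹|) * (2 * M N) := by
        rw [Finset.sum_mul]
    _ ≤ 2 * (2 * M N) := by
        have := kaluza_sum_abs_coeff_inv_le h0 hpos hanti hlog N
        have := hM0 N
        gcongr
    _ = 4 * M N := by ring

/-! ### Generalized binomial coefficients and Cesàro means -/

lemma ring_choose_succ_mul (r : ℝ) (k : ℕ) :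
    Ring.choose r (k + 1) * (k + 1) = (r - k) * Ring.choose r k := by
  rw [Ring.choose_eq_smul, Ring.choose_eq_smul, descPochhammer_succ_right,
    Polynomial.smeval_mul, Polynomial.smeval_sub, Polynomial.smeval_X, Polynomial.smeval_natCast]
  have h1 : ((k + 1).factorial : ℝ) = (k + 1) * k.factorial := by
    rw [Nat.factorial_succ]; push_cast; ring
  have h2 : (k.factorial : ℝ) ≠ 0 := by positivity
  have h3 : (k + 1 : ℝ) ≠ 0 := by positivity
  simp only [smul_eq_mul, pow_one, pow_zero, nsmul_eq_mul, mul_one]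
  rw [h1]
  field_simp

lemma ring_choose_add_one_succ_mul (r : ℝ) (k : ℕ) :
    Ring.choose (r + 1) (k + 1) * (k + 1) = (r + 1) * Ring.choose r k := by
  rw [Ring.choose_succ_succ, add_mul, ring_choose_succ_mul]
  ring

lemma cesaroNumber_zero (δ : ℝ) : cesaroNumber δ 0 = 1 := by
  simp [cesaroNumber]

lemma cesaroNumber_succ_mul (δ : ℝ) (n : ℕ) :
    cesaroNumber δ (n + 1) * (n + 1) = (n + 1 + δ) * cesaroNumber δ n := by
  have h := ring_choose_add_one_succ_mul (n + δ) n
  simp only [cesaroNumber]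
  push_cast
  rw [show (n : ℝ) + 1 + δ = n + δ + 1 by ring]
  exact h

lemma cesaroNumber_succ (δ : ℝ) (n : ℕ) :
    cesaroNumber δ (n + 1) = cesaroNumber δ n + cesaroNumber (δ - 1) (n + 1) := by
  simp only [cesaroNumber]
  push_cast
  rw [show (n : ℝ) + 1 + δ = n + δ + 1 by ring, Ring.choose_succ_succ,
    show (n : ℝ) + 1 + (δ - 1) = n + δ by ring]

lemma cesaroNumber_succ_eq (δ : ℝ) (n : ℕ) :
    cesaroNumber δ (n + 1) = (n + 1 + δ) / (n + 1) * cesaroNumber δ n := by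
  have h := cesaroNumber_succ_mul δ n
  have h3 : (n + 1 : ℝ) ≠ 0 := by positivity
  field_simp
  linarith

lemma cesaroNumber_pos {δ : ℝ} (hδ : -1 < δ) (n : ℕ) : 0 < cesaroNumber δ n := by
  induction n with
  | zero => rw [cesaroNumber_zero]; exact one_pos
  | succ n ih =>
    rw [cesaroNumber_succ_eq]
    have : (0 : ℝ) ≤ n := n.cast_nonneg
    have : 0 < n + 1 + δ := by linarith
    positivity

lemma cesaroNumber_le {δ : ℝ} (hδ0 : 0 ≤ δ) (hδ1 : δ ≤ 1) (n : ℕ) :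
    cesaroNumber δ n ≤ 2 * (n + 1 : ℝ) ^ δ := by
  have key : ∀ m : ℕ, cesaroNumber δ (m + 1) ≤ 2 * (m + 1 : ℝ) ^ δ := by
    intro m
    induction m with
    | zero =>
      rw [cesaroNumber_succ_eq, cesaroNumber_zero]
      norm_num
      linarith
    | succ m ih =>
      rw [cesaroNumber_succ_eq]
      push_cast
      have hm : (0 : ℝ) ≤ m := m.cast_nonneg
      set y : ℝ := m + 1 + 1 with hy
      have hy0 : 0 < y := by positivity
      have h1 : (1 + -(1 / y)) ^ δ ≤ 1 + δ * -(1 / y) := by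
        refine rpow_one_add_le_one_add_mul_self ?_ hδ0 hδ1
        rw [neg_le_neg_iff, div_le_one hy0]
        linarith
      have h2 : (m + 1 : ℝ) = y * (1 + -(1 / y)) := by
        rw [hy]; field_simp; ring
      have h5 : 0 ≤ 1 + -(1 / y) := by
        have : 1 / y ≤ 1 := by rw [div_le_one hy0]; linarith
        linarith
      have h3 : (m + 1 : ℝ) ^ δ ≤ y ^ δ * (1 - δ / y) := by
        rw [h2, Real.mul_rpow hy0.le h5]
        have : 1 - δ / y = 1 + δ * -(1 / y) := by ring
        rw [this]
        gcongr
      calc (y + δ) / y * cesaroNumber δ (m + 1)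
          ≤ (y + δ) / y * (2 * (y ^ δ * (1 - δ / y))) := by
            gcongr
            linarith
        _ = 2 * y ^ δ * (1 - (δ / y) ^ 2) := by field_simp; ring
        _ ≤ 2 * y ^ δ * 1 := by
            gcongr
            linarith [sq_nonneg (δ / y)]
        _ = 2 * y ^ δ := by ring
  rcases n with _ | m
  · rw [cesaroNumber_zero]; norm_num
  · refine (key m).trans ?_
    have hm : (0 : ℝ) ≤ m := m.cast_nonneg
    push_cast
    gcongr
    linarith

/-- The terms of a series with bounded Cesàro means of order `δ ∈ (0, 1)` are `O(n^δ)`. -/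
lemma abs_le_of_abs_cesaroMean_le {δ C : ℝ} (hδ0 : 0 < δ) (hδ1 : δ < 1) {a : ℕ → ℝ}
    (hC : ∀ N, |cesaroMean δ a N| ≤ C) (N : ℕ) : |a N| ≤ 8 * C * (N + 1 : ℝ) ^ δ := by
  have hC0 : 0 ≤ C := (abs_nonneg _).trans (hC 0)
  have hpos := cesaroNumber_pos (show -1 < δ by linarith)
  have hpos' := cesaroNumber_pos (show -1 < δ - 1 by linarith)
  have hmono : Monotone (cesaroNumber δ) := monotone_nat_of_le_succ fun n => by
    rw [cesaroNumber_succ]; linarith [hpos' (n + 1)]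
  have h := abs_le_of_abs_convolution_le (b := cesaroNumber δ) (d := cesaroNumber (δ - 1))
    (a := a) (M := fun n => C * cesaroNumber δ n) (cesaroNumber_zero _) hpos'
    (antitone_nat_of_succ_le fun n => by
      rw [cesaroNumber_succ_eq]
      have : (n + 1 + (δ - 1)) / (n + 1 : ℝ) ≤ 1 := by
        rw [div_le_one (by positivity)]; linarith
      nlinarith [hpos' n])
    (fun n => by
      rw [cesaroNumber_succ_eq (δ - 1) (n + 1)]
      have hn : (0 : ℝ) ≤ n := n.cast_nonneg
      have h1 : (n + 1 + (δ - 1)) / (n + 1 : ℝ) ≤ (n + 1 + 1 + (δ - 1)) / (n + 1 + 1 : ℝ) := by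
        rw [div_le_div_iff₀ (by positivity) (by positivity)]; nlinarith
      have h2 := cesaroNumber_succ_eq (δ - 1) n
      have h3 : cesaroNumber (δ - 1) (n + 1) ≤
          (n + 1 + 1 + (δ - 1)) / (n + 1 + 1 : ℝ) * cesaroNumber (δ - 1) n := by
        rw [h2]; exact mul_le_mul_of_nonneg_right h1 (hpos' n).le
      have h4 := mul_le_mul_of_nonneg_right h3 (hpos' (n + 1)).le
      push_cast
      nlinarith)
    (cesaroNumber_zero _) (cesaroNumber_succ δ) (hmono.const_mul hC0)
    (fun n => by
      have h1 : ∑ k ∈ Finset.range (n + 1), cesaroNumber δ (n - k) * a k =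
          cesaroNumber δ n * cesaroMean δ a n := by
        rw [cesaroMean, Finset.mul_sum]
        refine Finset.sum_congr rfl fun k _ => ?_
        have := (hpos n).ne'
        field_simp
      rw [h1, abs_mul, abs_of_pos (hpos n), mul_comm]
      exact mul_le_mul_of_nonneg_right (hC n) (hpos n).le) N
  have h2 := cesaroNumber_le hδ0.le hδ1.le N
  calc |a N| ≤ 4 * (C * cesaroNumber δ N) := h
    _ ≤ 4 * (C * (2 * (N + 1 : ℝ) ^ δ)) := by gcongr
    _ = _ := by ring

/-! ### Riesz means at the integers -/

/-- Log-convexity of the increments of `n ↦ n ^ δ`. By Cauchy's mean value theorem the quotient of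
two consecutive increments is `(1 + 1 / ξ) ^ (δ - 1)` with `ξ` between the nodes, which increases
with `ξ`. -/
lemma rpow_increment_logConvex {δ : ℝ} (hδ0 : 0 < δ) (hδ1 : δ < 1) (n : ℕ) :
    ((n + 2 : ℝ) ^ δ - (n + 1 : ℝ) ^ δ) ^ 2 ≤
      ((n + 1 : ℝ) ^ δ - (n : ℝ) ^ δ) * ((n + 3 : ℝ) ^ δ - (n + 2 : ℝ) ^ δ) := by
  have key : ∀ x : ℝ, 0 ≤ x → ∃ ξ ∈ Ioo x (x + 1),
      (x + 2) ^ δ - (x + 1) ^ δ = (1 + 1 / ξ) ^ (δ - 1) * ((x + 1) ^ δ - x ^ δ) := by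
    intro x hx
    obtain ⟨ξ, hξ, h⟩ := exists_ratio_hasDerivAt_eq_ratio_slope (fun y : ℝ => (y + 1) ^ δ)
      (fun y => δ * (y + 1) ^ (δ - 1)) (show x < x + 1 by linarith)
      (Continuous.continuousOn (by fun_prop (disch := exact hδ0.le)))
      (fun y hy => by
        have h1 := ((hasDerivAt_id y).add_const 1).rpow_const (p := δ)
          (Or.inl (by simp only [id]; linarith [hy.1]))
        simpa using h1)
      (fun y : ℝ => y ^ δ) (fun y => δ * y ^ (δ - 1))
      (Continuous.continuousOn (by fun_prop (disch := exact hδ0.le)))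
      (fun y hy => by
        have h1 := (hasDerivAt_id y).rpow_const (p := δ)
          (Or.inl (by simp only [id]; linarith [hy.1]))
        simpa using h1)
    have hξ0 : 0 < ξ := by linarith [hξ.1]
    refine ⟨ξ, hξ, ?_⟩
    have h2 : (1 + 1 / ξ) ^ (δ - 1) = (ξ + 1) ^ (δ - 1) / ξ ^ (δ - 1) := by
      rw [← Real.div_rpow (by positivity) hξ0.le]
      congr 1
      field_simp
    have h3 : 0 < ξ ^ (δ - 1) := Real.rpow_pos_of_pos hξ0 _
    rw [h2]
    field_simp
    rw [show x + 1 + 1 = x + 2 by ring] at h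
    have h4 : δ * (((x + 1) ^ δ - x ^ δ) * (ξ + 1) ^ (δ - 1)) =
        δ * (((x + 2) ^ δ - (x + 1) ^ δ) * ξ ^ (δ - 1)) := by linarith
    have h5 := mul_left_cancel₀ hδ0.ne' h4
    linarith
  obtain ⟨ξ, hξ, h1⟩ := key n n.cast_nonneg
  obtain ⟨η, hη, h2⟩ := key (n + 1) (by positivity)
  have hn : (0 : ℝ) ≤ n := n.cast_nonneg
  have hξ0 : 0 < ξ := by linarith [hξ.1]
  have hξη : ξ ≤ η := by linarith [hξ.2, hη.1]
  have h3 : (1 + 1 / ξ) ^ (δ - 1) ≤ (1 + 1 / η) ^ (δ - 1) := by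
    have hη0 : 0 < η := hξ0.trans_le hξη
    refine Real.rpow_le_rpow_of_nonpos (by positivity) ?_ (by linarith)
    gcongr
  rw [show (n : ℝ) + 1 + 2 = n + 3 by ring, show (n : ℝ) + 1 + 1 = n + 2 by ring] at h2
  have h4 : 0 ≤ (n + 1 : ℝ) ^ δ - (n : ℝ) ^ δ :=
    sub_nonneg.mpr (Real.rpow_le_rpow hn (by linarith) hδ0.le)
  have h5 : 0 ≤ (n + 2 : ℝ) ^ δ - (n + 1 : ℝ) ^ δ :=
    sub_nonneg.mpr (Real.rpow_le_rpow (by linarith) (by linarith) hδ0.le)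
  rw [h2, sq]
  calc _ = ((1 + 1 / ξ) ^ (δ - 1) * ((n + 1 : ℝ) ^ δ - (n : ℝ) ^ δ)) *
        ((n + 2 : ℝ) ^ δ - (n + 1 : ℝ) ^ δ) := by rw [← h1]
    _ ≤ ((1 + 1 / η) ^ (δ - 1) * ((n + 1 : ℝ) ^ δ - (n : ℝ) ^ δ)) *
        ((n + 2 : ℝ) ^ δ - (n + 1 : ℝ) ^ δ) := by gcongr
    _ = _ := by ring

/-- The terms of a series whose Riesz means of order `δ ∈ (0, 1)` are bounded along the positive
integers are `O(n^δ)`. -/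
lemma abs_le_of_abs_rieszMean_le {δ C : ℝ} (hδ0 : 0 < δ) (hδ1 : δ < 1) {a : ℕ → ℝ}
    (hC : ∀ N : ℕ, |rieszMean δ a (N + 1 : ℕ)| ≤ C) (N : ℕ) :
    |a N| ≤ 4 * C * (N + 1 : ℝ) ^ δ := by
  have hC0 : 0 ≤ C := (abs_nonneg _).trans (hC 0)
  have hlog : ∀ n : ℕ, (((n + 1 : ℕ) + 1 : ℝ) ^ δ - ((n + 1 : ℕ) : ℝ) ^ δ) ^ 2 ≤
      ((n + 1 : ℝ) ^ δ - (n : ℝ) ^ δ) *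
        (((n + 2 : ℕ) + 1 : ℝ) ^ δ - ((n + 2 : ℕ) : ℝ) ^ δ) := by
    intro n
    have := rpow_increment_logConvex hδ0 hδ1 n
    push_cast
    rw [show (n : ℝ) + 1 + 1 = n + 2 by ring, show (n : ℝ) + 2 + 1 = n + 3 by ring]
    exact this
  have hpos : ∀ n : ℕ, 0 < (n + 1 : ℝ) ^ δ - (n : ℝ) ^ δ := fun n =>
    sub_pos.mpr (Real.rpow_lt_rpow n.cast_nonneg (by linarith) hδ0)
  have h := abs_le_of_abs_convolution_le (b := fun j : ℕ => (j + 1 : ℝ) ^ δ)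
    (d := fun j : ℕ => (j + 1 : ℝ) ^ δ - (j : ℝ) ^ δ)
    (a := a) (M := fun n => C * (n + 1 : ℝ) ^ δ)
    (by simp [Real.zero_rpow hδ0.ne']) hpos
    (antitone_nat_of_succ_le fun n => by
      have hconc := (Real.concaveOn_rpow hδ0.le hδ1.le).2
        (show (n : ℝ) ∈ Ici 0 from mem_Ici.mpr n.cast_nonneg)
        (show (n + 2 : ℝ) ∈ Ici 0 from by simp only [mem_Ici]; positivity)
        (show (0 : ℝ) ≤ 1 / 2 by norm_num) (show (0 : ℝ) ≤ 1 / 2 by norm_num) (by norm_num)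
      simp only [smul_eq_mul] at hconc
      rw [show 1 / 2 * (n : ℝ) + 1 / 2 * (n + 2) = n + 1 by ring] at hconc
      push_cast
      rw [show (n : ℝ) + 1 + 1 = n + 2 by ring]
      linarith)
    hlog (by simp) (fun n => by push_cast; ring)
    (fun m n hmn => by
      have : (m : ℝ) ≤ n := by exact_mod_cast hmn
      have := Real.rpow_le_rpow (show (0 : ℝ) ≤ m + 1 by positivity)
        (show (m + 1 : ℝ) ≤ n + 1 by linarith) hδ0.le
      exact mul_le_mul_of_nonneg_left this hC0)
    (fun n => by
      have hn : (0 : ℝ) < n + 1 := by positivity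
      have h1 : ∑ k ∈ Finset.range (n + 1), (((n - k : ℕ) : ℝ) + 1) ^ δ * a k =
          (n + 1 : ℝ) ^ δ * rieszMean δ a (n + 1 : ℕ) := by
        rw [rieszMean, Finset.mul_sum, Nat.ceil_natCast]
        refine Finset.sum_congr rfl fun k hk => ?_
        have hk' : k ≤ n := Nat.lt_succ_iff.mp (Finset.mem_range.mp hk)
        have hk'' : (k : ℝ) ≤ n := by exact_mod_cast hk'
        rw [← mul_assoc, ← Real.mul_rpow hn.le, Nat.cast_sub hk']
        · congr 2
          push_cast
          field_simp
          ring
        · push_cast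
          rw [sub_nonneg, div_le_one hn]
          linarith
      rw [h1, abs_mul, abs_of_pos (Real.rpow_pos_of_pos hn _), mul_comm]
      exact mul_le_mul_of_nonneg_right (hC n) (Real.rpow_pos_of_pos hn _).le) N
  linarith

/-- Convergent Cesàro means of order `δ ∈ (0, 1)` force the terms to be `O(n^δ)`. -/
lemma exists_abs_le_of_tendsto_cesaroMean {δ : ℝ} (hδ0 : 0 < δ) (hδ1 : δ < 1) {a : ℕ → ℝ} {l : ℝ}
    (h : Tendsto (fun N : ℕ => cesaroMean δ a N) atTop (𝓝 l)) :
    ∃ C : ℝ, ∀ n : ℕ, |a n| ≤ C * (n + 1 : ℝ) ^ δ := by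
  obtain ⟨C, hC⟩ := h.abs.bddAbove_range
  exact ⟨8 * C, abs_le_of_abs_cesaroMean_le hδ0 hδ1 fun N => hC ⟨N, rfl⟩⟩

/-- Convergent Riesz means of order `δ ∈ (0, 1)` force the terms to be `O(n^δ)`. -/
lemma exists_abs_le_of_tendsto_rieszMean {δ : ℝ} (hδ0 : 0 < δ) (hδ1 : δ < 1) {a : ℕ → ℝ} {l : ℝ}
    (h : Tendsto (fun r : ℝ => rieszMean δ a r) atTop (𝓝 l)) :
    ∃ C : ℝ, ∀ n : ℕ, |a n| ≤ C * (n + 1 : ℝ) ^ δ := by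
  have h1 : Tendsto (fun N : ℕ => rieszMean δ a (N + 1 : ℕ)) atTop (𝓝 l) :=
    h.comp (tendsto_natCast_atTop_atTop.comp (tendsto_add_atTop_nat 1))
  obtain ⟨C, hC⟩ := h1.abs.bddAbove_range
  exact ⟨4 * C, abs_le_of_abs_rieszMean_le hδ0 hδ1 fun N => hC ⟨N, rfl⟩⟩

/-! ### Laguerre polynomials: differential equation and values near the origin -/

noncomputable section

/-- The Laguerre polynomial `L_n^{(α)}` as an element of `ℝ[X]`. -/
def laguerrePolynomial (α : ℝ) (n : ℕ) : Polynomial ℝ :=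
  ∑ k ∈ Finset.range (n + 1),
    Polynomial.monomial k (Ring.choose ((n : ℝ) + α) (n - k) * (-1) ^ k / (k.factorial : ℝ))

end

lemma eval_laguerrePolynomial (α : ℝ) (n : ℕ) (x : ℝ) :
    (laguerrePolynomial α n).eval x = laguerrePoly α n x := by
  simp only [laguerrePolynomial, laguerrePoly, Polynomial.eval_finsetSum,
    Polynomial.eval_monomial]
  refine Finset.sum_congr rfl fun k _ => ?_
  rw [neg_pow x]
  ring

lemma coeff_laguerrePolynomial (α : ℝ) (n k : ℕ) :
    (laguerrePolynomial α n).coeff k =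
      if k ≤ n then Ring.choose ((n : ℝ) + α) (n - k) * (-1) ^ k / (k.factorial : ℝ) else 0 := by
  simp [laguerrePolynomial, Polynomial.coeff_monomial]

lemma coeff_zero_laguerrePolynomial (α : ℝ) (n : ℕ) :
    (laguerrePolynomial α n).coeff 0 = cesaroNumber α n := by
  simp [coeff_laguerrePolynomial, cesaroNumber]

lemma coeff_succ_laguerrePolynomial (α : ℝ) (n k : ℕ) :
    (k + 1) * (k + 1 + α) * (laguerrePolynomial α n).coeff (k + 1) =
      -((n - k) * (laguerrePolynomial α n).coeff k) := by
  rw [coeff_laguerrePolynomial, coeff_laguerrePolynomial]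
  rcases lt_trichotomy k n with h | rfl | h
  · rw [if_pos (by omega), if_pos h.le]
    obtain ⟨m, rfl⟩ : ∃ m, n = k + 1 + m := ⟨n - (k + 1), by omega⟩
    have h1 := ring_choose_succ_mul (((k + 1 + m : ℕ) : ℝ) + α) m
    rw [show k + 1 + m - (k + 1) = m by omega, show k + 1 + m - k = m + 1 by omega]
    have h2 : ((k + 1).factorial : ℝ) = (k + 1) * k.factorial := by
      rw [Nat.factorial_succ]; push_cast; ring
    have h3 : (k.factorial : ℝ) ≠ 0 := by positivity
    have h4 : (k + 1 : ℝ) ≠ 0 := by positivity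
    rw [h2, pow_succ]
    push_cast at h1 ⊢
    field_simp
    linear_combination h1
  · simp
  · rw [if_neg (by omega), if_neg (by omega)]; simp

/-- Laguerre's differential equation `x L'' + (α + 1 - x) L' + n L = 0`. -/
lemma laguerrePolynomial_ode (α : ℝ) (n : ℕ) (x : ℝ) :
    x * (laguerrePolynomial α n).derivative.derivative.eval x +
      (α + 1 - x) * (laguerrePolynomial α n).derivative.eval x +
      n * (laguerrePolynomial α n).eval x = 0 := by
  have h : Polynomial.X * (laguerrePolynomial α n).derivative.derivative +
      (Polynomial.C (α + 1) - Polynomial.X) * (laguerrePolynomial α n).derivative +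
      Polynomial.C (n : ℝ) * laguerrePolynomial α n = 0 := by
    ext k
    rw [sub_mul]
    rcases k with _ | k
    · have h0 := coeff_succ_laguerrePolynomial α n 0
      simp only [Polynomial.coeff_add, Polynomial.coeff_sub,
        Polynomial.coeff_derivative, Polynomial.mul_coeff_zero, Polynomial.coeff_X_zero,
        Polynomial.coeff_C_zero, Polynomial.coeff_zero]
      push_cast at h0 ⊢
      linear_combination h0
    · have h0 := coeff_succ_laguerrePolynomial α n (k + 1)
      simp only [Polynomial.coeff_add, Polynomial.coeff_sub, Polynomial.coeff_C_mul,
        Polynomial.coeff_derivative, Polynomial.coeff_X_mul, Polynomial.coeff_zero]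
      push_cast at h0 ⊢
      linear_combination h0
  simpa using congrArg (Polynomial.eval x) h

/-- Near the origin, up to `x` of order `1 / n`, the Laguerre polynomial keeps half of its value
at `0`: the coefficients grow at most geometrically with ratio `2 n`. -/
lemma laguerrePoly_ge_half {α : ℝ} (hα : -1 / 2 < α) (n : ℕ) {x : ℝ} (hx0 : 0 ≤ x)
    (hx : 2 * n * x ≤ 1 / 4) : cesaroNumber α n / 2 ≤ laguerrePoly α n x := by
  set P := laguerrePolynomial α n with hP
  have hc0 : 0 < cesaroNumber α n := cesaroNumber_pos (by linarith) n
  have hn : (0 : ℝ) ≤ n := n.cast_nonneg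
  have hcoeff : ∀ k, |P.coeff k| ≤ cesaroNumber α n * (2 * n) ^ k := by
    intro k
    induction k with
    | zero => rw [hP, coeff_zero_laguerrePolynomial, abs_of_pos hc0]; simp
    | succ k ih =>
      have hk : (0 : ℝ) ≤ k := k.cast_nonneg
      have h1 := congrArg abs (coeff_succ_laguerrePolynomial α n k)
      rw [abs_mul, abs_neg, abs_mul (n - k : ℝ), abs_of_pos (a := (k + 1 : ℝ) * (k + 1 + α))
        (mul_pos (by linarith) (by linarith)), ← hP] at h1
      have h2 : |(n - k : ℝ)| * |P.coeff k| ≤ n * (cesaroNumber α n * (2 * n) ^ k) := by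
        by_cases hkn : k ≤ n
        · have hkn' : (k : ℝ) ≤ n := by exact_mod_cast hkn
          rw [abs_of_nonneg (by linarith)]
          gcongr
          linarith
        · rw [hP, coeff_laguerrePolynomial, if_neg hkn, abs_zero, mul_zero]
          positivity
      -- the assumption on `α` gives `k + 1 + α ≥ (k + 1) - 1 / 2`, hence the factor `1 / 2`
      have h3 : 1 / 2 * |P.coeff (k + 1)| ≤ (k + 1) * (k + 1 + α) * |P.coeff (k + 1)| := by
        refine mul_le_mul_of_nonneg_right ?_ (abs_nonneg _)
        nlinarith
      rw [pow_succ]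
      nlinarith
  have hdeg : P.natDegree ≤ n := by
    rw [Polynomial.natDegree_le_iff_coeff_eq_zero]
    intro k hk
    rw [hP, coeff_laguerrePolynomial, if_neg (by omega)]
  have heval : laguerrePoly α n x =
      (∑ k ∈ Finset.range n, P.coeff (k + 1) * x ^ (k + 1)) + cesaroNumber α n := by
    rw [← eval_laguerrePolynomial, Polynomial.eval_eq_sum_range' (Nat.lt_succ_of_le hdeg),
      Finset.sum_range_succ', coeff_zero_laguerrePolynomial]
    simp
  have hsum : |∑ k ∈ Finset.range n, P.coeff (k + 1) * x ^ (k + 1)| ≤ cesaroNumber α n / 2 := by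
    calc |∑ k ∈ Finset.range n, P.coeff (k + 1) * x ^ (k + 1)|
        ≤ ∑ k ∈ Finset.range n, |P.coeff (k + 1) * x ^ (k + 1)| :=
          Finset.abs_sum_le_sum_abs _ _
      _ ≤ ∑ k ∈ Finset.range n, cesaroNumber α n * (1 / 4) * (1 / 4 : ℝ) ^ k := by
          refine Finset.sum_le_sum fun k _ => ?_
          rw [abs_mul, abs_of_nonneg (pow_nonneg hx0 (k + 1))]
          calc |P.coeff (k + 1)| * x ^ (k + 1)
              ≤ cesaroNumber α n * (2 * n) ^ (k + 1) * x ^ (k + 1) := by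
                gcongr; exact hcoeff _
            _ = cesaroNumber α n * (2 * n * x) ^ (k + 1) := by rw [mul_pow (2 * (n : ℝ)) x]; ring
            _ ≤ cesaroNumber α n * (1 / 4 : ℝ) ^ (k + 1) := by gcongr
            _ = _ := by ring
      _ = cesaroNumber α n * (1 / 4) * ∑ k ∈ Finset.range n, (1 / 4 : ℝ) ^ k := by
          rw [Finset.mul_sum]
      _ ≤ cesaroNumber α n * (1 / 4) * (4 / 3) := by
          gcongr
          rw [geom_sum_eq (by norm_num)]
          have : (0 : ℝ) ≤ (1 / 4) ^ n := by positivity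
          rw [div_le_iff_of_neg (by norm_num)]
          linarith
      _ ≤ _ := by linarith
  rw [heval]
  linarith [neg_le_of_abs_le hsum]

lemma cesaroNumber_mul_Gamma {α : ℝ} (hα : -1 < α) (n : ℕ) :
    cesaroNumber α n * (Real.Gamma (α + 1) * Real.Gamma (n + 1)) = Real.Gamma (n + α + 1) := by
  induction n with
  | zero => simp [cesaroNumber_zero]
  | succ n ih =>
    have hn : (0 : ℝ) ≤ n := n.cast_nonneg
    push_cast
    rw [show (n : ℝ) + 1 + α + 1 = (n + α + 1) + 1 by ring, Real.Gamma_add_one (s := n + α + 1) (by linarith),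
      Real.Gamma_add_one (s := (n : ℝ) + 1) (by linarith), ← ih]
    linear_combination (Real.Gamma (α + 1) * Real.Gamma (n + 1)) * cesaroNumber_succ_mul α n

/-- The lower bound `binom(n + α, n) ≥ c n^α` for large `n`, from Euler's limit for `Γ`. -/
lemma exists_cesaroNumber_ge {α : ℝ} (hα : -1 < α) :
    ∃ c > 0, ∀ᶠ n : ℕ in atTop, c * (n : ℝ) ^ α ≤ cesaroNumber α n := by
  have hG : 0 < Real.Gamma (α + 1) := Real.Gamma_pos_of_pos (by linarith)
  have hlim := Real.GammaSeq_tendsto_Gamma (α + 1)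
  have hev := hlim.eventually (gt_mem_nhds (show Real.Gamma (α + 1) < 2 * Real.Gamma (α + 1) by
    linarith))
  have hprod : ∀ n : ℕ, ∏ j ∈ Finset.range (n + 1), (α + 1 + j) =
      cesaroNumber α n * n.factorial * (n + α + 1) := by
    intro n
    induction n with
    | zero => simp [cesaroNumber_zero]
    | succ n ih =>
      rw [Finset.prod_range_succ, ih, Nat.factorial_succ]
      push_cast
      linear_combination -(n.factorial * (n + 1 + α + 1) : ℝ) * cesaroNumber_succ_mul α n
  have hev2 : ∀ᶠ n : ℕ in atTop, α + 1 ≤ n :=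
    (tendsto_natCast_atTop_atTop).eventually_ge_atTop (α + 1)
  refine ⟨1 / (4 * Real.Gamma (α + 1)), by positivity, ?_⟩
  filter_upwards [hev, hev2, eventually_gt_atTop 0] with n h1 h2 h3
  have hn : (0 : ℝ) < n := by exact_mod_cast h3
  have hc0 : 0 < cesaroNumber α n := cesaroNumber_pos hα n
  have hf : (0 : ℝ) < n.factorial := by positivity
  rw [Real.GammaSeq, hprod, Real.rpow_add_one hn.ne', div_lt_iff₀
    (mul_pos (mul_pos hc0 hf) (by linarith))] at h1
  have h4 : (n : ℝ) ^ α * (n * n.factorial) ≤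
      4 * Real.Gamma (α + 1) * cesaroNumber α n * (n * n.factorial) := by
    calc (n : ℝ) ^ α * (n * n.factorial) = (n : ℝ) ^ α * n * n.factorial := by ring
      _ ≤ 2 * Real.Gamma (α + 1) * (cesaroNumber α n * n.factorial * (n + α + 1)) := h1.le
      _ ≤ 2 * Real.Gamma (α + 1) * (cesaroNumber α n * n.factorial * (n + n)) := by
          gcongr 2 * Real.Gamma (α + 1) * (cesaroNumber α n * n.factorial * ?_)
          linarith
      _ = _ := by ring
  have h5 := le_of_mul_le_mul_right h4 (by positivity)
  rw [one_div_mul_eq_div, div_le_iff₀ (by positivity)]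
  linarith

/-! ### The energy method for `u'' = -(ν² - t² - κ / t²) u` -/

/-- The energy `v² + (ν² - t²) u²`, with `v = u'`, of a solution of
`u'' = -(ν² - t² - κ / t²) u` varies only by a bounded factor between `1 / (2 ν)` and `ν / 2`: its
logarithmic derivative is at most the derivative of `2 t² / ν² - 2 |κ| / (ν t)`. -/
lemma energy_comparable {u v : ℝ → ℝ} {ν κ : ℝ} (hν : 0 < ν)
    (hu : ∀ t, 0 < t → HasDerivAt u (v t) t)
    (hv : ∀ t, 0 < t → HasDerivAt v (-(ν ^ 2 - t ^ 2 - κ / t ^ 2) * u t) t)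
    {s t : ℝ} (hs : s ∈ Icc (1 / (2 * ν)) (ν / 2)) (ht : t ∈ Icc (1 / (2 * ν)) (ν / 2)) :
    v t ^ 2 + (ν ^ 2 - t ^ 2) * u t ^ 2 ≤
      Real.exp (1 + 4 * |κ|) * (v s ^ 2 + (ν ^ 2 - s ^ 2) * u s ^ 2) := by
  set E : ℝ → ℝ := fun t => v t ^ 2 + (ν ^ 2 - t ^ 2) * u t ^ 2 with hE
  set g : ℝ → ℝ := fun t => 2 * t ^ 2 / ν ^ 2 - 2 * |κ| / ν * t⁻¹ with hg
  set I := Icc (1 / (2 * ν)) (ν / 2) with hI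
  have hIpos : ∀ x ∈ I, 0 < x := fun x hx => lt_of_lt_of_le (by positivity) hx.1
  have hE' : ∀ x ∈ I, HasDerivAt E (2 * κ * (u x * v x) / x ^ 2 - 2 * x * u x ^ 2) x := by
    intro x hx
    have hx0 := hIpos x hx
    have h1 := ((hv x hx0).pow 2).add
      ((((hasDerivAt_id x).pow 2).const_sub (ν ^ 2)).mul ((hu x hx0).pow 2))
    refine h1.congr_deriv ?_
    simp only [id, Nat.cast_ofNat, Nat.add_one_sub_one, pow_one, Pi.pow_apply]
    field_simp
    ring
  have hg' : ∀ x ∈ I, HasDerivAt g (4 * x / ν ^ 2 + 2 * |κ| / (ν * x ^ 2)) x := by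
    intro x hx
    have hx0 := hIpos x hx
    have h1 := ((((hasDerivAt_id x).pow 2).const_mul 2).div_const (ν ^ 2)).sub
      ((hasDerivAt_inv hx0.ne').const_mul (2 * |κ| / ν))
    refine h1.congr_deriv ?_
    simp only [id, Nat.cast_ofNat, Nat.add_one_sub_one, pow_one]
    field_simp
    ring
  -- staying below `ν / 2` keeps the local frequency comparable with `ν`
  have hfreq : ∀ x ∈ I, 3 / 4 * ν ^ 2 ≤ ν ^ 2 - x ^ 2 := by
    intro x hx
    have := hIpos x hx
    nlinarith [hx.2]
  have hE0 : ∀ x ∈ I, 0 ≤ E x := fun x hx => by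
    have := hfreq x hx
    have : 0 ≤ ν ^ 2 - x ^ 2 := le_trans (by positivity) this
    simp only [hE]
    positivity
  have hbound : ∀ x ∈ I, |2 * κ * (u x * v x) / x ^ 2 - 2 * x * u x ^ 2| ≤
      (4 * x / ν ^ 2 + 2 * |κ| / (ν * x ^ 2)) * E x := by
    intro x hx
    have hx0 := hIpos x hx
    have h1 := hfreq x hx
    have h2 : v x ^ 2 + 3 / 4 * ν ^ 2 * u x ^ 2 ≤ E x := by
      have := mul_le_mul_of_nonneg_right h1 (sq_nonneg (u x))
      simp only [hE]
      linarith
    have h3 : |u x * v x| ≤ E x / ν := by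
      rw [le_div_iff₀ hν, abs_mul]
      have := sq_nonneg (|v x| - 1 / 2 * (ν * |u x|))
      have e1 := sq_abs (v x)
      have e2 := sq_abs (u x)
      nlinarith [mul_nonneg (sq_nonneg ν) (sq_nonneg (u x))]
    have h4 : u x ^ 2 ≤ 2 * E x / ν ^ 2 := by
      rw [le_div_iff₀ (by positivity)]
      nlinarith [sq_nonneg (v x), mul_nonneg (sq_nonneg ν) (sq_nonneg (u x))]
    calc |2 * κ * (u x * v x) / x ^ 2 - 2 * x * u x ^ 2|
        ≤ |2 * κ * (u x * v x) / x ^ 2| + |2 * x * u x ^ 2| := abs_sub _ _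
      _ = 2 * |κ| * |u x * v x| / x ^ 2 + 2 * x * u x ^ 2 := by
          rw [abs_div, abs_mul, abs_mul, abs_of_pos (show (0 : ℝ) < 2 by norm_num),
            abs_of_nonneg (sq_nonneg x), abs_of_nonneg (show 0 ≤ 2 * x * u x ^ 2 by positivity)]
      _ ≤ 2 * |κ| * (E x / ν) / x ^ 2 + 2 * x * (2 * E x / ν ^ 2) := by gcongr
      _ = _ := by field_simp; ring
  have hanti : AntitoneOn (fun x => E x * Real.exp (-g x)) I := by
    have hd : ∀ x ∈ I, HasDerivAt (fun x => E x * Real.exp (-g x))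
        ((2 * κ * (u x * v x) / x ^ 2 - 2 * x * u x ^ 2) * Real.exp (-g x) +
          E x * (Real.exp (-g x) * -(4 * x / ν ^ 2 + 2 * |κ| / (ν * x ^ 2)))) x :=
      fun x hx => (hE' x hx).mul (hg' x hx).neg.exp
    refine antitoneOn_of_hasDerivWithinAt_nonpos (convex_Icc _ _)
      (fun x hx => (hd x hx).continuousAt.continuousWithinAt)
      (fun x hx => (hd x (interior_subset hx)).hasDerivWithinAt) fun x hx => ?_
    have h1 := (abs_le.mp (hbound x (interior_subset hx))).2
    have h2 := Real.exp_pos (-g x)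
    nlinarith
  have hmono : MonotoneOn (fun x => E x * Real.exp (g x)) I := by
    have hd : ∀ x ∈ I, HasDerivAt (fun x => E x * Real.exp (g x))
        ((2 * κ * (u x * v x) / x ^ 2 - 2 * x * u x ^ 2) * Real.exp (g x) +
          E x * (Real.exp (g x) * (4 * x / ν ^ 2 + 2 * |κ| / (ν * x ^ 2)))) x :=
      fun x hx => (hE' x hx).mul (hg' x hx).exp
    refine monotoneOn_of_hasDerivWithinAt_nonneg (convex_Icc _ _)
      (fun x hx => (hd x hx).continuousAt.continuousWithinAt)
      (fun x hx => (hd x (interior_subset hx)).hasDerivWithinAt) fun x hx => ?_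
    have h1 := (abs_le.mp (hbound x (interior_subset hx))).1
    have h2 := Real.exp_pos (g x)
    nlinarith
  have hgb : ∀ x ∈ I, -(4 * |κ|) ≤ g x ∧ g x ≤ 1 := by
    intro x hx
    have hx0 := hIpos x hx
    have h1 : 2 * x ^ 2 / ν ^ 2 ≤ 1 := by
      rw [div_le_one (by positivity)]
      nlinarith [hx.2]
    have h2 : 0 ≤ 2 * x ^ 2 / ν ^ 2 := by positivity
    have h3 : 0 ≤ 2 * |κ| / ν * x⁻¹ := by positivity
    have h4 : 2 * |κ| / ν * x⁻¹ ≤ 4 * |κ| := by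
      have h5 : x⁻¹ ≤ 2 * ν := by
        rw [inv_le_comm₀ hx0 (by positivity), ← one_div]
        exact hx.1
      calc 2 * |κ| / ν * x⁻¹ ≤ 2 * |κ| / ν * (2 * ν) := by gcongr
        _ = _ := by field_simp; ring
    simp only [hg]
    constructor <;> linarith
  have hgs := hgb s hs
  have hgt := hgb t ht
  have hEs := hE0 s hs
  change E t ≤ Real.exp (1 + 4 * |κ|) * E s
  rcases le_total s t with hst | hst
  · have h1 : E t * Real.exp (-g t) ≤ E s * Real.exp (-g s) := hanti hs ht hst
    calc E t = E t * Real.exp (-g t) * Real.exp (g t) := by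
          rw [mul_assoc, ← Real.exp_add]; simp
      _ ≤ E s * Real.exp (-g s) * Real.exp (g t) := by gcongr
      _ = Real.exp (-g s + g t) * E s := by rw [Real.exp_add]; ring
      _ ≤ _ := by
          refine mul_le_mul_of_nonneg_right (Real.exp_le_exp.mpr ?_) hEs
          linarith
  · have h1 : E t * Real.exp (g t) ≤ E s * Real.exp (g s) := hmono ht hs hst
    calc E t = E t * Real.exp (g t) * Real.exp (-g t) := by
          rw [mul_assoc, ← Real.exp_add]; simp
      _ ≤ E s * Real.exp (g s) * Real.exp (-g t) := by gcongr
      _ = Real.exp (g s + -g t) * E s := by rw [Real.exp_add]; ring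
      _ ≤ _ := by
          refine mul_le_mul_of_nonneg_right (Real.exp_le_exp.mpr ?_) hEs
          linarith

/-- A function with large slope on the set where it is small is small only on a small set. The
bound comes from integrating the derivative of `u' · arctan (u / h)`, which contains the term
`u'² h / (h² + u²)`, and this term is at least `m / (2 h)` where `|u| ≤ h`. -/
lemma mul_volume_abs_le_le {u v w : ℝ → ℝ} {a b h m V W : ℝ} (hab : a ≤ b)
    (hu : ∀ t ∈ Icc a b, HasDerivAt u (v t) t) (hv : ∀ t ∈ Icc a b, HasDerivAt v (w t) t)
    (hw : ContinuousOn w (Icc a b)) (hV : ∀ t ∈ Icc a b, |v t| ≤ V)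
    (hW : ∀ t ∈ Icc a b, |w t| ≤ W) (hh : 0 < h)
    (hm : ∀ t ∈ Icc a b, |u t| ≤ h → m ≤ v t ^ 2) (hm0 : 0 ≤ m) :
    m * volume.real {t ∈ Icc a b | |u t| ≤ h} ≤ 2 * h * (4 * V + 2 * W * (b - a)) := by
  have hatan : ∀ x : ℝ, |Real.arctan x| ≤ 2 := fun x => by
    rw [abs_le]
    constructor <;> linarith [Real.arctan_lt_pi_div_two x, Real.neg_pi_div_two_lt_arctan x,
      Real.pi_lt_four]
  have huc : ContinuousOn u (Icc a b) := fun t ht => (hu t ht).continuousAt.continuousWithinAt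
  have hvc : ContinuousOn v (Icc a b) := fun t ht => (hv t ht).continuousAt.continuousWithinAt
  set G : ℝ → ℝ := fun t => v t ^ 2 * (h / (h ^ 2 + u t ^ 2)) with hG
  set H : ℝ → ℝ := fun t => w t * Real.arctan (u t / h) with hH
  have hGc : ContinuousOn G (Icc a b) := by
    refine (hvc.pow 2).mul (continuousOn_const.div (continuousOn_const.add (huc.pow 2)) ?_)
    intro t _
    positivity
  have hHc : ContinuousOn H (Icc a b) :=
    hw.mul (Real.continuous_arctan.comp_continuousOn (huc.div_const h))
  have hF : ∀ t ∈ Icc a b, HasDerivAt (fun t => v t * Real.arctan (u t / h)) (H t + G t) t := by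
    intro t ht
    have h1 := (hv t ht).mul (((hu t ht).div_const h).arctan)
    refine h1.congr_deriv ?_
    simp only [hH, hG]
    congr 1
    field_simp
  have hGint : IntervalIntegrable G volume a b :=
    ContinuousOn.intervalIntegrable (by rwa [uIcc_of_le hab])
  have hHint : IntervalIntegrable H volume a b :=
    ContinuousOn.intervalIntegrable (by rwa [uIcc_of_le hab])
  have hFTC : ∫ t in a..b, (H t + G t) =
      v b * Real.arctan (u b / h) - v a * Real.arctan (u a / h) :=
    intervalIntegral.integral_eq_sub_of_hasDerivAt (f := fun t => v t * Real.arctan (u t / h))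
      (by rwa [uIcc_of_le hab]) (hHint.add hGint)
  rw [intervalIntegral.integral_add hHint hGint] at hFTC
  have hHb : ‖∫ t in a..b, H t‖ ≤ (W * 2) * |b - a| := by
    refine intervalIntegral.norm_integral_le_of_norm_le_const fun t ht => ?_
    rw [uIoc_of_le hab] at ht
    have ht' := Ioc_subset_Icc_self ht
    rw [Real.norm_eq_abs, abs_mul]
    exact mul_le_mul (hW t ht') (hatan _) (abs_nonneg _) ((abs_nonneg _).trans (hW t ht'))
  rw [abs_of_nonneg (sub_nonneg.mpr hab), Real.norm_eq_abs] at hHb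
  have hbd : ∀ t ∈ Icc a b, |v t * Real.arctan (u t / h)| ≤ V * 2 := by
    intro t ht
    rw [abs_mul]
    exact mul_le_mul (hV t ht) (hatan _) (abs_nonneg _) ((abs_nonneg _).trans (hV t ht))
  have hGle : ∫ t in a..b, G t ≤ 4 * V + 2 * W * (b - a) := by
    have e1 := abs_le.mp (hbd a (left_mem_Icc.mpr hab))
    have e2 := abs_le.mp (hbd b (right_mem_Icc.mpr hab))
    have e3 := abs_le.mp hHb
    linarith
  have hGS : ∀ t ∈ {t ∈ Icc a b | |u t| ≤ h}, m / (2 * h) ≤ G t := by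
    intro t ht
    have h2 : u t ^ 2 ≤ h ^ 2 := by
      rw [← sq_abs (u t)]
      exact pow_le_pow_left₀ (abs_nonneg _) ht.2 2
    calc m / (2 * h) = m * (h / (h ^ 2 + h ^ 2)) := by field_simp; ring
      _ ≤ v t ^ 2 * (h / (h ^ 2 + u t ^ 2)) := by
          have := hm t ht.1 ht.2
          gcongr
  have hmarkov := mul_meas_ge_le_integral_of_nonneg (μ := volume.restrict (Icc a b)) (f := G)
    (Eventually.of_forall fun t => by simp only [hG, Pi.zero_apply]; positivity)
    hGc.integrableOn_Icc (m / (2 * h))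
  have hSle : volume.real {t ∈ Icc a b | |u t| ≤ h} ≤
      (volume.restrict (Icc a b)).real {t | m / (2 * h) ≤ G t} := by
    have h1 : volume.real {t ∈ Icc a b | |u t| ≤ h} =
        (volume.restrict (Icc a b)).real {t ∈ Icc a b | |u t| ≤ h} := by
      rw [measureReal_def, measureReal_def, Measure.restrict_eq_self]
      exact fun t ht => ht.1
    rw [h1]
    exact measureReal_mono (fun t ht => hGS t ht) (measure_ne_top _ _)
  rw [integral_Icc_eq_integral_Ioc, ← intervalIntegral.integral_of_le hab] at hmarkov
  have h1 : m / (2 * h) * volume.real {t ∈ Icc a b | |u t| ≤ h} ≤ 4 * V + 2 * W * (b - a) :=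
    (mul_le_mul_of_nonneg_left hSle (by positivity)).trans (hmarkov.trans hGle)
  rw [div_mul_eq_mul_div, div_le_iff₀ (by positivity)] at h1
  linarith

/-- A solution of `u'' = -(ν² - t² - κ / t²) u` is rarely small compared with its amplitude
`R = √(energy) / ν`: where `u` is small, the energy forces `u'` to be large. -/
lemma volume_abs_le_amplitude {u v : ℝ → ℝ} {ν κ : ℝ} (hν : 0 < ν)
    (hu : ∀ t, 0 < t → HasDerivAt u (v t) t)
    (hv : ∀ t, 0 < t → HasDerivAt v (-(ν ^ 2 - t ^ 2 - κ / t ^ 2) * u t) t)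
    {a b R η : ℝ} (ha : 1 / (2 * ν) ≤ a) (hb : b ≤ ν / 2) (hab : 1 ≤ ν * (b - a)) (hR : 0 < R)
    (hRE : v a ^ 2 + (ν ^ 2 - a ^ 2) * u a ^ 2 = ν ^ 2 * R ^ 2)
    (hη : 0 < η) (hηK : 2 * Real.exp (1 + 4 * |κ|) * η ^ 2 ≤ 1) :
    volume.real {t ∈ Icc a b | |u t| ≤ η * R} ≤
      32 * Real.exp (1 + 4 * |κ|) ^ 2 * (1 + 2 * |κ|) * η * (b - a) := by
  set K := Real.exp (1 + 4 * |κ|) with hK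
  have hK1 : 1 ≤ K := Real.one_le_exp (by positivity)
  have hab' : a ≤ b := by
    by_contra h
    nlinarith
  have ha0 : 0 < a := lt_of_lt_of_le (by positivity) ha
  have hsub : ∀ t ∈ Icc a b, t ∈ Icc (1 / (2 * ν)) (ν / 2) := fun t ht =>
    ⟨ha.trans ht.1, ht.2.trans hb⟩
  have haI : a ∈ Icc (1 / (2 * ν)) (ν / 2) := hsub a (left_mem_Icc.mpr hab')
  have hpos : ∀ t ∈ Icc a b, 0 < t := fun t ht => ha0.trans_le ht.1
  have hup : ∀ t ∈ Icc a b, v t ^ 2 + (ν ^ 2 - t ^ 2) * u t ^ 2 ≤ K * (ν ^ 2 * R ^ 2) := by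
    intro t ht
    rw [← hRE]
    exact energy_comparable hν hu hv haI (hsub t ht)
  have hlow : ∀ t ∈ Icc a b, ν ^ 2 * R ^ 2 ≤ K * (v t ^ 2 + (ν ^ 2 - t ^ 2) * u t ^ 2) := by
    intro t ht
    rw [← hRE]
    exact energy_comparable hν hu hv (hsub t ht) haI
  have hfreq : ∀ t ∈ Icc a b, 3 / 4 * ν ^ 2 ≤ ν ^ 2 - t ^ 2 := by
    intro t ht
    have h1 := hpos t ht
    have h2 := (hsub t ht).2
    nlinarith
  have huR : ∀ t ∈ Icc a b, |u t| ≤ 2 * K * R := by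
    intro t ht
    refine abs_le_of_sq_le_sq ?_ (by positivity)
    have h1 := hup t ht
    have h2 := mul_le_mul_of_nonneg_right (hfreq t ht) (sq_nonneg (u t))
    have h3 : ν ^ 2 * u t ^ 2 ≤ ν ^ 2 * (2 * K * R ^ 2) := by
      nlinarith [sq_nonneg (v t), mul_nonneg (mul_nonneg (zero_le_one.trans hK1) (sq_nonneg ν))
        (sq_nonneg R)]
    have h4 := le_of_mul_le_mul_left h3 (by positivity)
    have h5 : K * R ^ 2 ≤ K * K * R ^ 2 := by
      gcongr
      nlinarith
    nlinarith
  have hvR : ∀ t ∈ Icc a b, |v t| ≤ K * ν * R := by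
    intro t ht
    refine abs_le_of_sq_le_sq ?_ (by positivity)
    have h1 := hup t ht
    have h2 : 0 ≤ (ν ^ 2 - t ^ 2) * u t ^ 2 :=
      mul_nonneg (le_trans (by positivity) (hfreq t ht)) (sq_nonneg _)
    have h5 : K * (ν ^ 2 * R ^ 2) ≤ K * K * (ν ^ 2 * R ^ 2) := by
      gcongr
      nlinarith
    nlinarith
  have hQ : ∀ t ∈ Icc a b, |ν ^ 2 - t ^ 2 - κ / t ^ 2| ≤ (1 + 4 * |κ|) * ν ^ 2 := by
    intro t ht
    have h1 := hpos t ht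
    have h2 := hfreq t ht
    have h3 : |κ / t ^ 2| ≤ 4 * |κ| * ν ^ 2 := by
      rw [abs_div, abs_of_nonneg (sq_nonneg t), div_le_iff₀ (by positivity)]
      have h4 : 1 ≤ 2 * ν * t := by
        have := (div_le_iff₀ (by positivity)).mp (hsub t ht).1
        linarith
      have h5 : (1 : ℝ) ≤ (2 * ν * t) ^ 2 := by nlinarith
      nlinarith [abs_nonneg κ]
    calc |ν ^ 2 - t ^ 2 - κ / t ^ 2| ≤ |ν ^ 2 - t ^ 2| + |κ / t ^ 2| := abs_sub _ _
      _ ≤ ν ^ 2 + 4 * |κ| * ν ^ 2 := by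
        gcongr
        rw [abs_of_nonneg (le_trans (by positivity) h2)]
        linarith [sq_nonneg t]
      _ = _ := by ring
  have huc : ContinuousOn u (Icc a b) := fun t ht =>
    (hu t (hpos t ht)).continuousAt.continuousWithinAt
  have hmain := mul_volume_abs_le_le (u := u) (v := v)
    (w := fun t => -(ν ^ 2 - t ^ 2 - κ / t ^ 2) * u t) (h := η * R) (m := ν ^ 2 * R ^ 2 / (2 * K))
    (V := K * ν * R) (W := (1 + 4 * |κ|) * ν ^ 2 * (2 * K * R)) hab'
    (fun t ht => hu t (hpos t ht)) (fun t ht => hv t (hpos t ht))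
    (by
      refine ContinuousOn.mul (ContinuousOn.neg (ContinuousOn.sub
        (by fun_prop) (continuousOn_const.div (by fun_prop) ?_))) huc
      intro t ht
      have := hpos t ht
      positivity)
    hvR
    (fun t ht => by
      rw [abs_mul, abs_neg]
      exact mul_le_mul (hQ t ht) (huR t ht) (abs_nonneg _) (by positivity))
    (by positivity)
    (fun t ht hut => by
      have h1 := hlow t ht
      have h2 : u t ^ 2 ≤ (η * R) ^ 2 := by
        rw [← sq_abs (u t)]
        exact pow_le_pow_left₀ (abs_nonneg _) hut 2
      have h3 : (ν ^ 2 - t ^ 2) * u t ^ 2 ≤ ν ^ 2 * (η * R) ^ 2 :=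
        mul_le_mul (by linarith [sq_nonneg t]) h2 (sq_nonneg _) (sq_nonneg _)
      have h5 : 2 * K * (ν ^ 2 * (η * R) ^ 2) ≤ ν ^ 2 * R ^ 2 := by
        calc 2 * K * (ν ^ 2 * (η * R) ^ 2) = (2 * K * η ^ 2) * (ν ^ 2 * R ^ 2) := by ring
          _ ≤ 1 * (ν ^ 2 * R ^ 2) := by gcongr
          _ = _ := one_mul _
      have h6 := mul_le_mul_of_nonneg_left h3 (zero_le_one.trans hK1)
      rw [div_le_iff₀ (by positivity)]
      linarith)
    (by positivity)
  have h1 : K * ν * R ≤ K * (ν ^ 2 * R * (b - a)) := by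
    have : K * ν * R * 1 ≤ K * ν * R * (ν * (b - a)) := by gcongr
    linarith
  have h2 : ν ^ 2 * R ^ 2 / (2 * K) * volume.real {t ∈ Icc a b | |u t| ≤ η * R} ≤
      ν ^ 2 * R ^ 2 / (2 * K) * (32 * K ^ 2 * (1 + 2 * |κ|) * η * (b - a)) := by
    refine hmain.trans ?_
    calc 2 * (η * R) * (4 * (K * ν * R) + 2 * ((1 + 4 * |κ|) * ν ^ 2 * (2 * K * R)) * (b - a))
        ≤ 2 * (η * R) * (4 * (K * (ν ^ 2 * R * (b - a))) +
            2 * ((1 + 4 * |κ|) * ν ^ 2 * (2 * K * R)) * (b - a)) := by gcongr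
      _ = _ := by field_simp; ring
  exact le_of_mul_le_mul_left h2 (by positivity)

/-! ### Laguerre functions in the variable `t = √x` -/

noncomputable section

/-- The frequency `ν = √(4 n + 2 α + 2)`, at which `√t 𝓛_n^α(t²)` oscillates. -/
def laguerreFreq (α : ℝ) (n : ℕ) : ℝ := √(4 * n + 2 * α + 2)

/-- The function `√t 𝓛_n^α(t²)` of `t > 0`, written out in terms of the Laguerre polynomial. -/
def laguerreOsc (α : ℝ) (n : ℕ) (t : ℝ) : ℝ :=
  √(Real.Gamma ((n : ℝ) + 1) / Real.Gamma ((n : ℝ) + α + 1)) *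
    (Real.exp (-t ^ 2 / 2) * t ^ (α + 1 / 2) * (laguerrePolynomial α n).eval (t ^ 2))

/-- The derivative of `laguerreOsc`. -/
def laguerreOscDeriv (α : ℝ) (n : ℕ) (t : ℝ) : ℝ :=
  √(Real.Gamma ((n : ℝ) + 1) / Real.Gamma ((n : ℝ) + α + 1)) *
    (Real.exp (-t ^ 2 / 2) * t ^ (α + 1 / 2) *
      ((-t + (α + 1 / 2) / t) * (laguerrePolynomial α n).eval (t ^ 2) +
        2 * t * (laguerrePolynomial α n).derivative.eval (t ^ 2)))

end

lemma laguerreOsc_eq (α : ℝ) (n : ℕ) {t : ℝ} (ht : 0 < t) :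
    laguerreOsc α n t = √t * laguerreFun α n (t ^ 2) := by
  have h1 : (t ^ 2) ^ (α / 2) = t ^ α := by
    rw [← Real.rpow_natCast, ← Real.rpow_mul ht.le]
    congr 1
    push_cast
    ring
  rw [laguerreOsc, laguerreFun, eval_laguerrePolynomial, h1, Real.rpow_add ht, Real.sqrt_eq_rpow t]
  ring

lemma laguerreFreq_sq {α : ℝ} (hα : -1 / 2 < α) (n : ℕ) :
    laguerreFreq α n ^ 2 = 4 * n + 2 * α + 2 := by
  have : (0 : ℝ) ≤ n := n.cast_nonneg
  exact Real.sq_sqrt (by linarith)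

lemma laguerreFreq_pos {α : ℝ} (hα : -1 / 2 < α) (n : ℕ) : 0 < laguerreFreq α n := by
  have : (0 : ℝ) ≤ n := n.cast_nonneg
  exact Real.sqrt_pos.mpr (by linarith)

lemma tendsto_laguerreFreq (α : ℝ) : Tendsto (laguerreFreq α) atTop atTop := by
  refine Real.tendsto_sqrt_atTop.comp ?_
  have h : Tendsto (fun n : ℕ => (4 : ℝ) * n) atTop atTop :=
    tendsto_natCast_atTop_atTop.const_mul_atTop (by norm_num)
  simpa only [add_assoc] using tendsto_atTop_add_const_right atTop (2 * α + 2) h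

lemma hasDerivAt_exp_mul_rpow (s : ℝ) {t : ℝ} (ht : 0 < t) :
    HasDerivAt (fun t : ℝ => Real.exp (-t ^ 2 / 2) * t ^ s)
      (Real.exp (-t ^ 2 / 2) * t ^ s * (-t + s / t)) t := by
  have h1 : HasDerivAt (fun t : ℝ => Real.exp (-t ^ 2 / 2)) (Real.exp (-t ^ 2 / 2) * (-t)) t := by
    refine HasDerivAt.exp ?_
    refine (((hasDerivAt_id t).pow 2).neg.div_const 2).congr_deriv ?_
    simp
    ring
  have h2 : HasDerivAt (fun t : ℝ => t ^ s) (s * t ^ (s - 1)) t :=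
    Real.hasDerivAt_rpow_const (Or.inl ht.ne')
  refine (h1.mul h2).congr_deriv ?_
  rw [Real.rpow_sub_one ht.ne']
  ring

lemma hasDerivAt_eval_sq (P : Polynomial ℝ) (t : ℝ) :
    HasDerivAt (fun t : ℝ => P.eval (t ^ 2)) (2 * t * P.derivative.eval (t ^ 2)) t := by
  have h := (P.hasDerivAt (t ^ 2)).comp t ((hasDerivAt_id t).pow 2)
  refine h.congr_deriv ?_
  simp
  ring

lemma hasDerivAt_laguerreOsc (α : ℝ) (n : ℕ) {t : ℝ} (ht : 0 < t) :
    HasDerivAt (laguerreOsc α n) (laguerreOscDeriv α n t) t := by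
  have h := ((hasDerivAt_exp_mul_rpow (α + 1 / 2) ht).mul
    (hasDerivAt_eval_sq (laguerrePolynomial α n) t)).const_mul
      √(Real.Gamma ((n : ℝ) + 1) / Real.Gamma ((n : ℝ) + α + 1))
  refine h.congr_deriv ?_
  rw [laguerreOscDeriv]
  ring

/-- In the variable `t = √x`, Laguerre's equation becomes `u'' = -(ν² - t² - (α² - 1/4) / t²) u`. -/
lemma hasDerivAt_laguerreOscDeriv {α : ℝ} (hα : -1 / 2 < α) (n : ℕ) {t : ℝ} (ht : 0 < t) :
    HasDerivAt (laguerreOscDeriv α n)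
      (-(laguerreFreq α n ^ 2 - t ^ 2 - (α ^ 2 - 1 / 4) / t ^ 2) * laguerreOsc α n t) t := by
  have hlin : HasDerivAt (fun t : ℝ => -t + (α + 1 / 2) / t) (-1 - (α + 1 / 2) / t ^ 2) t := by
    refine ((hasDerivAt_id t).neg.add
      ((hasDerivAt_inv ht.ne').const_mul (α + 1 / 2))).congr_deriv ?_
    field_simp
    ring
  have h2 : HasDerivAt (fun t : ℝ => 2 * t) 2 t := by
    simpa using (hasDerivAt_id t).const_mul (2 : ℝ)
  have h := ((hasDerivAt_exp_mul_rpow (α + 1 / 2) ht).mul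
    ((hlin.mul (hasDerivAt_eval_sq (laguerrePolynomial α n) t)).add
      (h2.mul (hasDerivAt_eval_sq (laguerrePolynomial α n).derivative t)))).const_mul
      √(Real.Gamma ((n : ℝ) + 1) / Real.Gamma ((n : ℝ) + α + 1))
  refine h.congr_deriv ?_
  rw [laguerreOsc, laguerreFreq_sq hα]
  have hode := laguerrePolynomial_ode α n (t ^ 2)
  simp only [Pi.add_apply, Pi.mul_apply]
  field_simp
  linear_combination
    (64 * √(Real.Gamma ((n : ℝ) + 1) / Real.Gamma ((n : ℝ) + α + 1)) * t ^ 2) * hode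

/-- The energy of `√t 𝓛_n^α(t²)` between `1 / (2 ν)` and `ν / 2` is at least of order `ν`: it is
comparable with its value at `1 / (2 ν)`, where the Laguerre polynomial is comparable with its
value `binom(n + α, n)` at the origin. -/
lemma exists_energy_laguerreOsc_ge {α : ℝ} (hα : -1 / 2 < α) :
    ∃ c > 0, ∀ᶠ n : ℕ in atTop,
      ∀ t ∈ Icc (1 / (2 * laguerreFreq α n)) (laguerreFreq α n / 2),
        c * laguerreFreq α n ≤ laguerreOscDeriv α n t ^ 2 +
          (laguerreFreq α n ^ 2 - t ^ 2) * laguerreOsc α n t ^ 2 := by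
  obtain ⟨c, hc, hev⟩ := exists_cesaroNumber_ge (show -1 < α by linarith)
  have hG : 0 < Real.Gamma (α + 1) := Real.Gamma_pos_of_pos (by linarith)
  set K := Real.exp (1 + 4 * |α ^ 2 - 1 / 4|) with hK
  have hK0 : 0 < K := Real.exp_pos _
  set c₁ := (1 / 8 : ℝ) ^ |α| with hc₁
  have hc₁0 : 0 < c₁ := by positivity
  refine ⟨1 / K * (3 / 4 * ((2 : ℝ) ^ (-(2 * α + 1)) * (c * c₁) / (16 * Real.Gamma (α + 1)))),
    by positivity, ?_⟩
  have hev2 : ∀ᶠ n : ℕ in atTop, α + 1 ≤ n :=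
    (tendsto_natCast_atTop_atTop).eventually_ge_atTop (α + 1)
  filter_upwards [hev, hev2, eventually_gt_atTop 0] with n h1 h2 h3 t ht
  have hn : (1 : ℝ) ≤ n := by exact_mod_cast h3
  set ν := laguerreFreq α n with hν
  have hν0 : 0 < ν := laguerreFreq_pos hα n
  have hνsq : ν ^ 2 = 4 * n + 2 * α + 2 := laguerreFreq_sq hα n
  have hν1 : 1 ≤ ν := by nlinarith
  set s := 1 / (2 * ν) with hs
  have hs0 : 0 < s := by positivity
  have hsν : s * ν = 1 / 2 := by rw [hs]; field_simp
  have hs1 : s ≤ 1 / 2 := by nlinarith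
  have hsmem : s ∈ Icc s (ν / 2) := ⟨le_rfl, by linarith⟩
  have hcomp := energy_comparable hν0 (fun t ht => hasDerivAt_laguerreOsc α n ht)
    (fun t ht => hasDerivAt_laguerreOscDeriv hα n ht) ht hsmem
  have hcn : 0 < cesaroNumber α n := cesaroNumber_pos (by linarith) n
  -- the value of the oscillation at `s`
  have hval : (2 : ℝ) ^ (-(2 * α + 1)) * (c * c₁) / (16 * Real.Gamma (α + 1)) * ν ≤
      ν ^ 2 * laguerreOsc α n s ^ 2 := by
    have hP : cesaroNumber α n / 2 ≤ (laguerrePolynomial α n).eval (s ^ 2) := by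
      rw [eval_laguerrePolynomial]
      refine laguerrePoly_ge_half hα n (sq_nonneg s) ?_
      have h4 : s ^ 2 * ν ^ 2 = 1 / 4 := by rw [← mul_pow, hsν]; norm_num
      rw [hνsq] at h4
      nlinarith [sq_nonneg s]
    have hexp : 1 / 2 ≤ Real.exp (-s ^ 2 / 2) := by
      have := Real.add_one_le_exp (-s ^ 2 / 2)
      nlinarith
    have hGn := cesaroNumber_mul_Gamma (show -1 < α by linarith) n
    have hGpos : 0 < Real.Gamma ((n : ℝ) + 1) := Real.Gamma_pos_of_pos (by linarith)
    have hN : Real.Gamma ((n : ℝ) + 1) / Real.Gamma ((n : ℝ) + α + 1) =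
        1 / (cesaroNumber α n * Real.Gamma (α + 1)) := by
      rw [← hGn]
      field_simp
    have hpow : (s ^ (α + 1 / 2)) ^ 2 = (2 : ℝ) ^ (-(2 * α + 1)) * ν ^ (-(2 * α + 1)) := by
      rw [← Real.mul_rpow (by norm_num) hν0.le, Real.rpow_neg (by positivity),
        ← Real.inv_rpow (by positivity), ← one_div, ← hs, ← Real.rpow_natCast,
        ← Real.rpow_mul hs0.le]
      congr 1
      push_cast
      ring
    have hU : 1 / (cesaroNumber α n * Real.Gamma (α + 1)) *
        ((2 : ℝ) ^ (-(2 * α + 1)) * ν ^ (-(2 * α + 1)) * (cesaroNumber α n / 4) ^ 2) ≤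
          laguerreOsc α n s ^ 2 := by
      rw [laguerreOsc, mul_pow, Real.sq_sqrt (by rw [hN]; positivity), hN, mul_pow, mul_pow, hpow]
      have h5 : (cesaroNumber α n / 4) ^ 2 ≤
          Real.exp (-s ^ 2 / 2) ^ 2 * (laguerrePolynomial α n).eval (s ^ 2) ^ 2 := by
        rw [← mul_pow]
        refine pow_le_pow_left₀ (by positivity) ?_ 2
        calc cesaroNumber α n / 4 = 1 / 2 * (cesaroNumber α n / 2) := by ring
          _ ≤ _ := mul_le_mul hexp hP (by positivity) (by positivity)
      calc _ ≤ 1 / (cesaroNumber α n * Real.Gamma (α + 1)) *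
          ((2 : ℝ) ^ (-(2 * α + 1)) * ν ^ (-(2 * α + 1)) *
            (Real.exp (-s ^ 2 / 2) ^ 2 * (laguerrePolynomial α n).eval (s ^ 2) ^ 2)) := by gcongr
        _ = _ := by ring
    have hpown : c₁ * ν ^ (2 * α) ≤ (n : ℝ) ^ α := by
      have h6 : ν ^ (2 * α) = (ν ^ 2) ^ α := by
        rw [← Real.rpow_natCast, ← Real.rpow_mul hν0.le]
        norm_num
      have h7 : (n : ℝ) = n / ν ^ 2 * ν ^ 2 := by field_simp
      have h8 : 1 / 8 ≤ n / ν ^ 2 := by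
        rw [le_div_iff₀ (by positivity), hνsq]; linarith
      have h9 : n / ν ^ 2 ≤ 1 := by
        rw [div_le_one (by positivity), hνsq]; linarith
      have h10 : 0 < n / ν ^ 2 := by linarith
      rw [h6, h7, Real.mul_rpow h10.le (by positivity)]
      refine mul_le_mul_of_nonneg_right ?_ (by positivity)
      calc c₁ ≤ (n / ν ^ 2) ^ |α| := Real.rpow_le_rpow (by norm_num) h8 (abs_nonneg _)
        _ ≤ (n / ν ^ 2) ^ α := Real.rpow_le_rpow_of_exponent_ge h10 h9 (le_abs_self _)
    have hνpow : ν ^ 2 * ν ^ (-(2 * α + 1)) * ν ^ (2 * α) = ν := by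
      rw [← Real.rpow_natCast, ← Real.rpow_add hν0, ← Real.rpow_add hν0]
      convert Real.rpow_one ν using 2
      push_cast
      ring
    calc (2 : ℝ) ^ (-(2 * α + 1)) * (c * c₁) / (16 * Real.Gamma (α + 1)) * ν
        = (2 : ℝ) ^ (-(2 * α + 1)) / (16 * Real.Gamma (α + 1)) *
            (ν ^ 2 * ν ^ (-(2 * α + 1)) * (c * (c₁ * ν ^ (2 * α)))) := by
          linear_combination (-(2 : ℝ) ^ (-(2 * α + 1)) * (c * c₁) / (16 * Real.Gamma (α + 1))) *
            hνpow
      _ ≤ (2 : ℝ) ^ (-(2 * α + 1)) / (16 * Real.Gamma (α + 1)) *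
            (ν ^ 2 * ν ^ (-(2 * α + 1)) * (c * (n : ℝ) ^ α)) := by gcongr
      _ ≤ (2 : ℝ) ^ (-(2 * α + 1)) / (16 * Real.Gamma (α + 1)) *
            (ν ^ 2 * ν ^ (-(2 * α + 1)) * cesaroNumber α n) := by gcongr
      _ = ν ^ 2 * (1 / (cesaroNumber α n * Real.Gamma (α + 1)) *
            ((2 : ℝ) ^ (-(2 * α + 1)) * ν ^ (-(2 * α + 1)) * (cesaroNumber α n / 4) ^ 2)) := by
          field_simp
          norm_num
      _ ≤ _ := by gcongr
  have hEs : 3 / 4 * (ν ^ 2 * laguerreOsc α n s ^ 2) ≤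
      laguerreOscDeriv α n s ^ 2 + (ν ^ 2 - s ^ 2) * laguerreOsc α n s ^ 2 := by
    have h4 : 3 / 4 * ν ^ 2 ≤ ν ^ 2 - s ^ 2 := by nlinarith
    nlinarith [mul_le_mul_of_nonneg_right h4 (sq_nonneg (laguerreOsc α n s)),
      sq_nonneg (laguerreOscDeriv α n s)]
  rw [mul_assoc, one_div_mul_eq_div, div_le_iff₀ hK0]
  linarith

/-- In the oscillatory range, `√t |𝓛_n^α(t²)|` exceeds a small multiple of `ν^{-1/2}` outside a
set of small relative measure, uniformly in `n` and in the interval considered. -/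
lemma exists_volume_laguerreFun_le {α : ℝ} (hα : -1 / 2 < α) {ε : ℝ} (hε : 0 < ε) :
    ∃ η > 0, ∀ᶠ n : ℕ in atTop, ∀ a b : ℝ, 1 / (2 * laguerreFreq α n) ≤ a →
      b ≤ laguerreFreq α n / 2 → 1 ≤ laguerreFreq α n * (b - a) →
        volume.real {t ∈ Icc a b | √t * |laguerreFun α n (t ^ 2)| ≤ η / √(laguerreFreq α n)} ≤
          ε * (b - a) := by
  obtain ⟨c, hc, hev⟩ := exists_energy_laguerreOsc_ge hα
  set κ := α ^ 2 - 1 / 4 with hκ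
  set K := Real.exp (1 + 4 * |κ|) with hK
  have hK0 : 0 < K := Real.exp_pos _
  set B := 32 * K ^ 2 * (1 + 2 * |κ|) with hB
  have hB0 : 0 < B := by positivity
  obtain ⟨θ, hθ0, hθ1, hθ2⟩ : ∃ θ : ℝ, 0 < θ ∧ B * θ ≤ ε ∧ 2 * K * θ ^ 2 ≤ 1 := by
    refine ⟨min (ε / B) (1 / (2 * K + 1)), by positivity, ?_, ?_⟩
    · calc B * min (ε / B) (1 / (2 * K + 1)) ≤ B * (ε / B) := by gcongr; exact min_le_left _ _
        _ = ε := by field_simp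
    · have h1 : (2 * K + 1) * min (ε / B) (1 / (2 * K + 1)) ≤ 1 := by
        calc _ ≤ (2 * K + 1) * (1 / (2 * K + 1)) := by gcongr; exact min_le_right _ _
          _ = 1 := by field_simp
      have h2 : 0 < min (ε / B) (1 / (2 * K + 1)) := by positivity
      nlinarith
  refine ⟨θ * √c, by positivity, ?_⟩
  filter_upwards [hev] with n hn a b ha hb hab
  set ν := laguerreFreq α n with hν
  have hν0 : 0 < ν := laguerreFreq_pos hα n
  have hab' : a ≤ b := by
    by_contra h
    nlinarith
  have ha0 : 0 < a := lt_of_lt_of_le (by positivity) ha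
  have hEa := hn a ⟨ha, hab'.trans hb⟩
  set E := laguerreOscDeriv α n a ^ 2 + (ν ^ 2 - a ^ 2) * laguerreOsc α n a ^ 2 with hE
  have hE0 : 0 < E := lt_of_lt_of_le (by positivity) hEa
  have hR : √c / √ν ≤ √E / ν := by
    rw [div_le_div_iff₀ (by positivity) hν0]
    calc √c * ν = √(c * ν) * √ν := by
          rw [Real.sqrt_mul hc.le, mul_assoc, Real.mul_self_sqrt hν0.le]
      _ ≤ √E * √ν := by gcongr
  have hmain := volume_abs_le_amplitude hν0 (fun t ht => hasDerivAt_laguerreOsc α n ht)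
    (fun t ht => hasDerivAt_laguerreOscDeriv hα n ht) ha hb hab (R := √E / ν) (by positivity)
    (by rw [div_pow, Real.sq_sqrt hE0.le]; field_simp; rfl) hθ0 hθ2
  refine le_trans (measureReal_mono ?_ ?_) (hmain.trans ?_)
  · intro t ht
    refine ⟨ht.1, ?_⟩
    have ht0 : 0 < t := ha0.trans_le ht.1.1
    rw [laguerreOsc_eq α n ht0, abs_mul, abs_of_nonneg (Real.sqrt_nonneg t)]
    refine ht.2.trans ?_
    rw [mul_div_assoc]
    gcongr
  · exact ((measure_mono fun t ht => ht.1).trans_lt isCompact_Icc.measure_lt_top).ne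
  · have : 0 ≤ b - a := sub_nonneg.mpr hab'
    exact mul_le_mul_of_nonneg_right hθ1 this

/-! ### Unbounded coefficients -/

/-- The Banach–Steinhaus theorem for pairings with functions of the dual Lebesgue space: if no
multiple of the weights `w` bounds the norms of the functionals `f ↦ ∫ f φ_n`, then no multiple of
`w` bounds the values of these functionals at a suitable `f`. -/
lemma exists_memLp_unbounded_pairing {X : Type*} [MeasurableSpace X] {μ : Measure X}
    {p q : ENNReal} [Fact (1 ≤ p)] [Fact (1 ≤ q)] [ENNReal.HolderConjugate p q] {φ : ℕ → X → ℝ}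
    (hφ : ∀ n, MemLp (φ n) q μ) {w : ℕ → ℝ} (hw : ∀ n, 0 < w n)
    (h : ∀ C : ℝ, ∃ n, ∃ g : X → ℝ, MemLp g p μ ∧
      C * w n * (eLpNorm g p μ).toReal < |∫ x, g x * φ n x ∂μ|) :
    ∃ f : X → ℝ, MemLp f p μ ∧ ∀ C : ℝ, ∃ n, C * w n < |∫ x, f x * φ n x ∂μ| := by
  by_contra! hcon
  set T : ℕ → Lp ℝ p μ →L[ℝ] ℝ := fun n =>
    (w n)⁻¹ • ((ContinuousLinearMap.mul ℝ ℝ).lpPairing μ p q).flip ((hφ n).toLp (φ n)) with hT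
  have hTapp : ∀ n (f : Lp ℝ p μ), T n f = (w n)⁻¹ * ∫ x, f x * φ n x ∂μ := by
    intro n f
    simp only [hT, _root_.smul_apply, ContinuousLinearMap.flip_apply,
      ContinuousLinearMap.lpPairing_eq_integral, ContinuousLinearMap.mul_apply', smul_eq_mul]
    congr 1
    refine integral_congr_ae ?_
    filter_upwards [(hφ n).coeFn_toLp] with x hx
    rw [hx]
  obtain ⟨C, hC⟩ := banach_steinhaus (g := T) fun f => by
    obtain ⟨C, hC⟩ := hcon f (Lp.memLp f)
    refine ⟨C, fun n => ?_⟩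
    rw [hTapp, Real.norm_eq_abs, abs_mul, abs_of_pos (inv_pos.mpr (hw n)),
      inv_mul_le_iff₀ (hw n), mul_comm]
    exact hC n
  obtain ⟨n, g, hg, hlt⟩ := h C
  have h1 := (T n).le_of_opNorm_le (hC n) (hg.toLp g)
  rw [hTapp, Real.norm_eq_abs, abs_mul, abs_of_pos (inv_pos.mpr (hw n)),
    inv_mul_le_iff₀ (hw n), Lp.norm_toLp] at h1
  have h2 : ∫ x, (hg.toLp g) x * φ n x ∂μ = ∫ x, g x * φ n x ∂μ := by
    refine integral_congr_ae ?_
    filter_upwards [hg.coeFn_toLp] with x hx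
    rw [hx]
  rw [h2] at h1
  linarith

lemma continuousOn_laguerreFun (α : ℝ) (n : ℕ) : ContinuousOn (laguerreFun α n) (Ioi 0) := by
  unfold laguerreFun
  refine ContinuousOn.mul (ContinuousOn.mul (by fun_prop) ?_) ?_
  · exact fun x hx => (Real.continuousAt_rpow_const _ _ (Or.inl (ne_of_gt hx))).continuousWithinAt
  · unfold laguerrePoly
    fun_prop

/-- The Laguerre functions lie in `L^q(0, ∞)` for `1 < q < 4 / 3`; the restriction on `q` takes
care of the singularity `x^{α / 2}`, `α / 2 > -1 / 4`, at the origin. -/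
lemma memLp_laguerreFun {α q : ℝ} (hα : -1 / 2 < α) (hq1 : 1 < q) (hq : q < 4 / 3) (n : ℕ) :
    MemLp (laguerreFun α n) (ENNReal.ofReal q) (volume.restrict (Ioi (0 : ℝ))) := by
  have hterm : ∀ k : ℕ, MemLp (fun x : ℝ => x ^ (α / 2 + k) * Real.exp (-(1 / 2) * x))
      (ENNReal.ofReal q) (volume.restrict (Ioi (0 : ℝ))) := by
    intro k
    have hk : (0 : ℝ) ≤ k := k.cast_nonneg
    have hmeas : AEStronglyMeasurable (fun x : ℝ => x ^ (α / 2 + k) * Real.exp (-(1 / 2) * x))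
        (volume.restrict (Ioi (0 : ℝ))) :=
      ((measurable_id.pow_const _).mul (by fun_prop)).aestronglyMeasurable
    rw [← integrable_norm_rpow_iff hmeas (by simpa using by linarith) ENNReal.ofReal_ne_top,
      ENNReal.toReal_ofReal (by linarith)]
    have h1 := integrableOn_rpow_mul_exp_neg_mul_rpow (p := 1) (s := (α / 2 + k) * q) (b := q / 2)
      (by nlinarith) one_pos (by linarith)
    refine (integrableOn_congr_fun (fun x hx => ?_) measurableSet_Ioi).mp h1
    have hx0 : 0 < x := hx
    rw [Real.norm_of_nonneg (by positivity), Real.mul_rpow (by positivity) (by positivity),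
      ← Real.rpow_mul hx0.le, ← Real.exp_mul, Real.rpow_one]
    congr 2
    ring
  have hsum := memLp_finsetSum (Finset.range (n + 1)) fun k _ =>
    (hterm k).const_mul (√(Real.Gamma ((n : ℝ) + 1) / Real.Gamma ((n : ℝ) + α + 1)) *
      (Ring.choose ((n : ℝ) + α) (n - k) * (-1) ^ k / (k.factorial : ℝ)))
  refine hsum.ae_eq ?_
  refine (ae_restrict_mem measurableSet_Ioi).mono fun x hx => ?_
  have hx0 : 0 < x := hx
  simp only [laguerreFun, laguerrePoly, Finset.mul_sum]
  refine Finset.sum_congr rfl fun k _ => ?_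
  rw [Real.rpow_add hx0, Real.rpow_natCast, neg_pow x,
    show -x / 2 = -(1 / 2) * x by ring]
  ring

/-- The `L¹` norm of `𝓛_n^α` over `[ν² / 16, ν² / 4]` is at least of order `ν`, that is, `√n`. -/
lemma exists_integral_abs_laguerreFun_ge {α : ℝ} (hα : -1 / 2 < α) :
    ∃ c > 0, ∀ᶠ n : ℕ in atTop, c * laguerreFreq α n ≤
      ∫ x in (laguerreFreq α n / 4) ^ 2..(laguerreFreq α n / 2) ^ 2, |laguerreFun α n x| := by
  obtain ⟨η, hη, hev⟩ := exists_volume_laguerreFun_le hα (show (0 : ℝ) < 1 / 2 by norm_num)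
  refine ⟨η / 8, by positivity, ?_⟩
  filter_upwards [hev, (tendsto_laguerreFreq α).eventually_ge_atTop 2] with n hn hν2
  set ν := laguerreFreq α n with hν
  have hν0 : 0 < ν := laguerreFreq_pos hα n
  have hab : ν / 4 ≤ ν / 2 := by linarith
  have hvol := hn (ν / 4) (ν / 2) (by
    rw [div_le_div_iff₀ (by positivity) (by norm_num)]; nlinarith) le_rfl (by nlinarith)
  have hpos : ∀ t ∈ Icc (ν / 4) (ν / 2), 0 < t := fun t ht => lt_of_lt_of_le (by positivity) ht.1
  have hcont : ContinuousOn (fun x => |laguerreFun α n x|) (Ioi 0) :=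
    (continuousOn_laguerreFun α n).abs
  have hsub := intervalIntegral.integral_comp_mul_deriv' (a := ν / 4) (b := ν / 2)
    (f := fun t : ℝ => t ^ 2) (f' := fun t => 2 * t) (g := fun x => |laguerreFun α n x|)
    (fun t _ => by simpa using hasDerivAt_pow 2 t) (by fun_prop)
    (hcont.mono (by
      rw [uIcc_of_le hab]
      rintro _ ⟨t, ht, rfl⟩
      have := hpos t ht
      exact mem_Ioi.mpr (by positivity)))
  rw [← hsub, intervalIntegral.integral_of_le hab, ← integral_Icc_eq_integral_Ioc]
  set F : ℝ → ℝ := fun t => ((fun x => |laguerreFun α n x|) ∘ fun t => t ^ 2) t * (2 * t) with hF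
  have hFc : ContinuousOn F (Icc (ν / 4) (ν / 2)) := by
    refine ContinuousOn.mul (hcont.comp (by fun_prop) fun t ht => ?_) (by fun_prop)
    have := hpos t ht
    exact mem_Ioi.mpr (by positivity)
  have hF0 : 0 ≤ᵐ[volume.restrict (Icc (ν / 4) (ν / 2))] F :=
    (ae_restrict_mem measurableSet_Icc).mono fun t ht => by
      have := hpos t ht
      simp only [hF, Pi.zero_apply, Function.comp]
      positivity
  have hmarkov := mul_meas_ge_le_integral_of_nonneg hF0 hFc.integrableOn_Icc η
  have hcover : Icc (ν / 4) (ν / 2) ⊆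
      {t ∈ Icc (ν / 4) (ν / 2) | √t * |laguerreFun α n (t ^ 2)| ≤ η / √ν} ∪ {t | η ≤ F t} := by
    intro t ht
    by_cases h : √t * |laguerreFun α n (t ^ 2)| ≤ η / √ν
    · exact Or.inl ⟨ht, h⟩
    · right
      have ht0 := hpos t ht
      rw [not_le, div_lt_iff₀ (by positivity)] at h
      have h1 : √ν ≤ 2 * √t := by
        rw [Real.sqrt_le_left (by positivity), mul_pow, Real.sq_sqrt ht0.le]
        linarith [ht.1]
      change η ≤ |laguerreFun α n (t ^ 2)| * (2 * t)
      calc η ≤ √t * |laguerreFun α n (t ^ 2)| * √ν := h.le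
        _ ≤ √t * |laguerreFun α n (t ^ 2)| * (2 * √t) := by gcongr
        _ = |laguerreFun α n (t ^ 2)| * (2 * (√t * √t)) := by ring
        _ = _ := by rw [Real.mul_self_sqrt ht0.le]
  have hmeas : ν / 8 ≤ (volume.restrict (Icc (ν / 4) (ν / 2))).real {t | η ≤ F t} := by
    have h1 : (volume.restrict (Icc (ν / 4) (ν / 2))).real (Icc (ν / 4) (ν / 2)) = ν / 4 := by
      rw [measureReal_restrict_apply_self, Real.volume_real_Icc_of_le hab]
      ring
    have h2 : (volume.restrict (Icc (ν / 4) (ν / 2))).real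
        {t ∈ Icc (ν / 4) (ν / 2) | √t * |laguerreFun α n (t ^ 2)| ≤ η / √ν} ≤ ν / 8 := by
      rw [measureReal_def, Measure.restrict_eq_self _ (fun t ht => ht.1), ← measureReal_def]
      linarith
    have h3 := (measureReal_mono hcover (measure_ne_top _ _)).trans
      (measureReal_union_le (μ := volume.restrict (Icc (ν / 4) (ν / 2))) _ _)
    linarith
  calc η / 8 * ν = η * (ν / 8) := by ring
    _ ≤ η * (volume.restrict (Icc (ν / 4) (ν / 2))).real {t | η ≤ F t} := by gcongr
    _ ≤ _ := hmarkov

/-- For `p > 4` and `β < 1/2 - 1/p` some `f ∈ L^p(0, ∞)` has Laguerre coefficients that are not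
`O(n^β)`. The functionals `f ↦ c_n(f)` are tested on the sign of `𝓛_n^α`, restricted to
`[ν² / 16, ν² / 4]`. -/
lemma exists_memLp_laguerreCoeff_unbounded {α p β : ℝ} (hα : -1 / 2 < α) (hp : 4 < p)
    (hβ0 : 0 ≤ β) (hβ : β < 1 / 2 - 1 / p) :
    ∃ f : ℝ → ℝ, MemLp f (ENNReal.ofReal p) (volume.restrict (Ioi (0 : ℝ))) ∧
      (∀ n : ℕ, IntegrableOn (fun x => f x * laguerreFun α n x) (Ioi (0 : ℝ))) ∧
      ∀ C : ℝ, ∃ n : ℕ, C * (n + 1 : ℝ) ^ β < |laguerreCoeff α f n| := by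
  have hpq : p.HolderConjugate (p.conjExponent) := Real.HolderConjugate.conjExponent (by linarith)
  set q := p.conjExponent with hq
  have hq1 : 1 < q := hpq.symm.lt
  have hq2 : q < 4 / 3 := by
    rw [hq, Real.conjExponent, div_lt_div_iff₀ (by linarith) (by norm_num)]
    linarith
  have hinst : ENNReal.HolderConjugate (ENNReal.ofReal p) (ENNReal.ofReal q) := hpq.ennrealOfReal
  have hp1 : Fact (1 ≤ ENNReal.ofReal p) := ⟨by
    rw [← ENNReal.ofReal_one]; exact ENNReal.ofReal_le_ofReal (by linarith)⟩
  have hq1' : Fact (1 ≤ ENNReal.ofReal q) := ⟨by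
    rw [← ENNReal.ofReal_one]; exact ENNReal.ofReal_le_ofReal hq1.le⟩
  have hmem := fun n => memLp_laguerreFun hα hq1 hq2 n
  have hp0 : 0 < p := by linarith
  obtain ⟨c, hc, hev⟩ := exists_integral_abs_laguerreFun_ge hα
  obtain ⟨f, hf, hunb⟩ := exists_memLp_unbounded_pairing (p := ENNReal.ofReal p)
    (q := ENNReal.ofReal q) (μ := volume.restrict (Ioi (0 : ℝ))) (φ := laguerreFun α) hmem
    (w := fun n : ℕ => (n + 1 : ℝ) ^ β) (fun n => by positivity) (by
      intro C
      -- the norm of the `n`-th functional is at least `c ν ^ (1 - 2 / p)`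
      have hexp : 0 < 1 - 2 / p - 2 * β := by
        have : 2 / p = 2 * (1 / p) := by ring
        linarith
      have hlarge := ((tendsto_rpow_atTop hexp).comp
        (tendsto_laguerreFreq α)).eventually_gt_atTop (|C| / c)
      obtain ⟨n, hn, hCn, hνn, hn1⟩ := (hev.and (hlarge.and
        (((tendsto_laguerreFreq α).eventually_ge_atTop 1).and (eventually_ge_atTop 1)))).exists
      set ν := laguerreFreq α n with hν
      have hν0 : 0 < ν := laguerreFreq_pos hα n
      have hn1' : (1 : ℝ) ≤ n := by exact_mod_cast hn1
      set I := Icc ((ν / 4) ^ 2) ((ν / 2) ^ 2) with hI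
      have hIle : (ν / 4) ^ 2 ≤ (ν / 2) ^ 2 := by nlinarith
      have hIsub : I ⊆ Ioi 0 := fun x hx => lt_of_lt_of_le (by positivity) hx.1
      set g : ℝ → ℝ := fun x => I.indicator (fun x => (SignType.sign (laguerreFun α n x) : ℝ)) x
        with hg
      have hgmeas : AEStronglyMeasurable g (volume.restrict (Ioi (0 : ℝ))) := by
        refine AEStronglyMeasurable.indicator ?_ measurableSet_Icc
        have h1 : AEMeasurable (laguerreFun α n) (volume.restrict (Ioi (0 : ℝ))) :=
          (continuousOn_laguerreFun α n).aemeasurable measurableSet_Ioi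
        have h2 : Measurable fun y : ℝ => (SignType.sign y : ℝ) := by
          have h3 : (fun y : ℝ => (SignType.sign y : ℝ)) =
              fun y => if 0 < y then 1 else if y < 0 then -1 else 0 := by
            funext y
            rw [sign_apply]
            split_ifs <;> simp
          rw [h3]
          exact Measurable.ite measurableSet_Ioi measurable_const
            (Measurable.ite measurableSet_Iio measurable_const measurable_const)
        exact (h2.comp_aemeasurable h1).aestronglyMeasurable
      have hgle : ∀ x, ‖g x‖ ≤ ‖I.indicator (fun _ => (1 : ℝ)) x‖ := by
        intro x
        simp only [hg]
        by_cases hx : x ∈ I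
        · rw [indicator_of_mem hx, indicator_of_mem hx]
          rcases lt_trichotomy (laguerreFun α n x) 0 with h | h | h <;> simp [h]
        · rw [indicator_of_notMem hx, indicator_of_notMem hx]
      have hIfin : (volume.restrict (Ioi (0 : ℝ))) I ≠ ⊤ :=
        ((Measure.restrict_apply_le _ _).trans_lt isCompact_Icc.measure_lt_top).ne
      have hind : MemLp (I.indicator fun _ => (1 : ℝ)) (ENNReal.ofReal p)
          (volume.restrict (Ioi (0 : ℝ))) :=
        memLp_indicator_const _ measurableSet_Icc _ (Or.inr hIfin)
      have hgmem : MemLp g (ENNReal.ofReal p) (volume.restrict (Ioi (0 : ℝ))) :=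
        hind.mono hgmeas (Eventually.of_forall hgle)
      have hgnorm : (eLpNorm g (ENNReal.ofReal p) (volume.restrict (Ioi (0 : ℝ)))).toReal ≤
          ν ^ (2 / p) := by
        have h1 : (eLpNorm g (ENNReal.ofReal p) (volume.restrict (Ioi (0 : ℝ)))).toReal ≤
            (eLpNorm (I.indicator fun _ => (1 : ℝ)) (ENNReal.ofReal p)
              (volume.restrict (Ioi (0 : ℝ)))).toReal :=
          ENNReal.toReal_mono hind.2.ne (eLpNorm_mono hgle)
        rw [eLpNorm_indicator_const measurableSet_Icc (by simpa using hp0)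
          ENNReal.ofReal_ne_top, ENNReal.toReal_ofReal hp0.le, ENNReal.toReal_mul,
          ← ENNReal.toReal_rpow, Measure.restrict_eq_self _ hIsub, hI, Real.volume_Icc,
          ENNReal.toReal_ofReal (by linarith)] at h1
        refine h1.trans ?_
        simp only [enorm_one, ENNReal.toReal_one, one_mul]
        have h2 : ν ^ (2 / p) = (ν ^ 2) ^ (1 / p) := by
          rw [← Real.rpow_natCast, ← Real.rpow_mul hν0.le]
          congr 1
          push_cast
          ring
        rw [h2]
        exact Real.rpow_le_rpow (by linarith) (by nlinarith) (by positivity)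
      refine ⟨n, g, hgmem, ?_⟩
      have hpair : ∫ x, g x * laguerreFun α n x ∂(volume.restrict (Ioi (0 : ℝ))) =
          ∫ x in (ν / 4) ^ 2..(ν / 2) ^ 2, |laguerreFun α n x| := by
        have h1 : (fun x => g x * laguerreFun α n x) =
            I.indicator fun x => |laguerreFun α n x| := by
          funext x
          simp only [hg]
          by_cases hx : x ∈ I
          · rw [indicator_of_mem hx, indicator_of_mem hx, sign_mul_self]
          · rw [indicator_of_notMem hx, indicator_of_notMem hx, zero_mul]
        rw [h1, integral_indicator measurableSet_Icc, Measure.restrict_restrict measurableSet_Icc,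
          inter_eq_self_of_subset_left hIsub, integral_Icc_eq_integral_Ioc,
          intervalIntegral.integral_of_le hIle]
      rw [hpair]
      refine lt_of_lt_of_le ?_ (hn.trans (le_abs_self _))
      have hw : (n + 1 : ℝ) ^ β ≤ ν ^ (2 * β) := by
        rw [Real.rpow_mul hν0.le, Real.rpow_two, laguerreFreq_sq hα]
        exact Real.rpow_le_rpow (by positivity) (by linarith) hβ0
      have hsplit : ν ^ (2 * β) * ν ^ (2 / p) * ν ^ (1 - 2 / p - 2 * β) = ν := by
        rw [← Real.rpow_add hν0, ← Real.rpow_add hν0]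
        convert Real.rpow_one ν using 2
        ring
      have hCn' : |C| < c * ν ^ (1 - 2 / p - 2 * β) := by
        rw [div_lt_iff₀ hc] at hCn
        simpa [mul_comm] using hCn
      calc C * (n + 1 : ℝ) ^ β *
            (eLpNorm g (ENNReal.ofReal p) (volume.restrict (Ioi (0 : ℝ)))).toReal
          ≤ |C| * ν ^ (2 * β) * ν ^ (2 / p) := by
            gcongr
            exact le_abs_self C
        _ = |C| * (ν ^ (2 * β) * ν ^ (2 / p)) := by ring
        _ < c * ν ^ (1 - 2 / p - 2 * β) * (ν ^ (2 * β) * ν ^ (2 / p)) := by gcongr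
        _ = c * ν := by linear_combination c * hsplit)
  refine ⟨f, hf, fun n => ?_, hunb⟩
  exact hf.integrable_mul (hmem n)

/-! ### Almost everywhere divergence -/

/-- A Cantor–Lebesgue type statement: coefficients exceeding every multiple of `n^{δ + 1/4}` along
arbitrarily large `n` make the terms `c_n 𝓛_n^α(x)` exceed every multiple of `n^δ`, for almost
every `x`. -/
lemma ae_not_exists_abs_mul_laguerreFun_le {α δ : ℝ} (hα : -1 / 2 < α) {c : ℕ → ℝ}
    (hc : ∀ (C : ℝ) (N : ℕ), ∃ n ≥ N, C * (n + 1 : ℝ) ^ (δ + 1 / 4) < |c n|) :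
    ∀ᵐ x ∂(volume.restrict (Ioi (0 : ℝ))),
      ¬ ∃ C : ℝ, ∀ n : ℕ, |c n * laguerreFun α n x| ≤ C * (n + 1 : ℝ) ^ δ := by
  set B : ℝ → ℝ → ℕ → Set ℝ := fun a b M =>
    {t ∈ Icc a b | ∀ n : ℕ, |c n * laguerreFun α n (t ^ 2)| ≤ M * (n + 1 : ℝ) ^ δ} with hB
  have hnull : ∀ a b : ℝ, 0 < a → a < b → ∀ M : ℕ, volume (B a b M) = 0 := by
    intro a b ha hab M
    have hfin : volume (B a b M) ≠ ⊤ :=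
      ((measure_mono fun t ht => ht.1).trans_lt isCompact_Icc.measure_lt_top).ne
    have hsmall : ∀ ε > 0, volume.real (B a b M) ≤ ε * (b - a) := by
      intro ε hε
      obtain ⟨η, hη, hev⟩ := exists_volume_laguerreFun_le hα hε
      have hb : 0 < b := ha.trans hab
      have hν := tendsto_laguerreFreq α
      obtain ⟨N, hN⟩ := eventually_atTop.mp (hev.and ((hν.eventually_ge_atTop (1 / (2 * a))).and
        ((hν.eventually_ge_atTop (2 * b)).and ((hν.eventually_ge_atTop (1 / (b - a))).and
          ((tendsto_natCast_atTop_atTop (R := ℝ)).eventually_ge_atTop (α + 1))))))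
      -- With this multiple, `|c_n 𝓛_n^α(t²)| ≤ M (n + 1)^δ` puts `t` in the set of small measure, as
      -- `√ν ≤ 2 (n + 1)^{1/4}`; the summand `1` keeps it positive.
      set Λ := 2 * √b * M / η + 1 with hΛ
      have hΛ0 : 0 < Λ := by positivity
      obtain ⟨n, hn, hcn⟩ := hc Λ N
      obtain ⟨h1, h2, h3, h4, h5⟩ := hN n hn
      set ν := laguerreFreq α n with hνdef
      have hν0 : 0 < ν := laguerreFreq_pos hα n
      have hba : 0 < b - a := sub_pos.mpr hab
      have hkey := h1 a b
        (by rw [div_le_iff₀ (by positivity)] at h2 ⊢; linarith) (by linarith)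
        (by rwa [div_le_iff₀ hba] at h4)
      refine le_trans (measureReal_mono ?_ ?_) hkey
      · intro t ht
        refine ⟨ht.1, ?_⟩
        have hn0 : (0 : ℝ) < n + 1 := by positivity
        have ht2 := ht.2 n
        rw [abs_mul] at ht2
        have hνle : √ν ≤ 2 * (n + 1 : ℝ) ^ (1 / 4 : ℝ) := by
          refine Real.sqrt_le_iff.mpr ⟨by positivity, ?_⟩
          refine abs_le_of_sq_le_sq' ?_ (by positivity) |>.2
          have h6 : ((2 * (n + 1 : ℝ) ^ (1 / 4 : ℝ)) ^ 2) ^ 2 = 16 * (n + 1) := by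
            have h7 : ((n + 1 : ℝ) ^ (1 / 4 : ℝ)) ^ 4 = n + 1 := by
              rw [← Real.rpow_natCast, ← Real.rpow_mul hn0.le]
              norm_num
            calc _ = 16 * ((n + 1 : ℝ) ^ (1 / 4 : ℝ)) ^ 4 := by ring
              _ = _ := by rw [h7]
          rw [h6, laguerreFreq_sq hα]
          linarith
        have hbd : Λ * (n + 1 : ℝ) ^ (1 / 4 : ℝ) * |laguerreFun α n (t ^ 2)| ≤ M := by
          have h8 : (n + 1 : ℝ) ^ δ * (Λ * (n + 1 : ℝ) ^ (1 / 4 : ℝ) * |laguerreFun α n (t ^ 2)|) ≤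
              (n + 1 : ℝ) ^ δ * M := by
            calc _ = Λ * (n + 1 : ℝ) ^ (δ + 1 / 4) * |laguerreFun α n (t ^ 2)| := by
                  rw [Real.rpow_add hn0]; ring
              _ ≤ |c n| * |laguerreFun α n (t ^ 2)| := by gcongr
              _ ≤ _ := by linarith
          exact le_of_mul_le_mul_left h8 (by positivity)
        rw [le_div_iff₀ (by positivity)]
        have h9 : √t ≤ √b := Real.sqrt_le_sqrt ht.1.2
        have h10 : Λ * (√t * |laguerreFun α n (t ^ 2)| * √ν) ≤ Λ * η := by
          calc Λ * (√t * |laguerreFun α n (t ^ 2)| * √ν)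
              ≤ Λ * (√b * |laguerreFun α n (t ^ 2)| * (2 * (n + 1 : ℝ) ^ (1 / 4 : ℝ))) := by
                gcongr
            _ = 2 * √b * (Λ * (n + 1 : ℝ) ^ (1 / 4 : ℝ) * |laguerreFun α n (t ^ 2)|) := by ring
            _ ≤ 2 * √b * M := by gcongr
            _ = (Λ - 1) * η := by rw [hΛ]; field_simp; ring
            _ ≤ Λ * η := by nlinarith
        exact le_of_mul_le_mul_left h10 hΛ0
      · exact ((measure_mono fun t ht => ht.1).trans_lt isCompact_Icc.measure_lt_top).ne
    have hzero : volume.real (B a b M) ≤ 0 := by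
      refine le_of_forall_pos_le_add fun ε hε => ?_
      have hba : 0 < b - a := sub_pos.mpr hab
      have := hsmall (ε / (b - a)) (by positivity)
      rw [div_mul_cancel₀ _ hba.ne'] at this
      linarith
    exact (measureReal_eq_zero_iff hfin).mp (le_antisymm hzero measureReal_nonneg)
  have hU : volume (⋃ (j : ℕ) (M : ℕ), B (1 / (j + 1)) (j + 2) M) = 0 := by
    refine measure_iUnion_null fun j => measure_iUnion_null fun M => hnull _ _ (by positivity) ?_ M
    have hj : (0 : ℝ) ≤ j := j.cast_nonneg
    rw [div_lt_iff₀ (by positivity)]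
    nlinarith
  -- the exceptional set in `x` is contained in the image of a null set under `t ↦ t ^ 2`
  have himage := addHaar_image_eq_zero_of_differentiableOn_of_addHaar_eq_zero volume
    (f := fun t : ℝ => t ^ 2) (by fun_prop) hU
  rw [ae_restrict_iff' measurableSet_Ioi, ae_iff]
  refine measure_mono_null (fun x hx => ?_) himage
  simp only [mem_ofPred_eq, Classical.not_imp, not_not, mem_Ioi] at hx
  obtain ⟨hx0, C, hC⟩ := hx
  have ht0 : 0 < √x := Real.sqrt_pos.mpr hx0
  refine ⟨√x, ?_, Real.sq_sqrt hx0.le⟩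
  obtain ⟨j, hj⟩ := exists_nat_ge (max (√x) (1 / √x))
  obtain ⟨M, hM⟩ := exists_nat_ge C
  have hj1 := (le_max_left _ _).trans hj
  have hj2 := (le_max_right _ _).trans hj
  refine mem_iUnion.mpr ⟨j, mem_iUnion.mpr ⟨M, ⟨?_, by linarith⟩, fun n => ?_⟩⟩
  · rw [div_le_iff₀ ht0] at hj2
    rw [div_le_iff₀ (by positivity)]
    linarith
  · rw [Real.sq_sqrt hx0.le]
    refine (hC n).trans ?_
    gcongr

theorem mainTheorem2 (α p δ : ℝ) (hα : -1 / 2 < α) (hp : 4 < p)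
    (hδ0 : 0 < δ) (hδ : δ < 1 / 4 - 1 / p) :
    ∃ f : ℝ → ℝ,
      MemLp f (ENNReal.ofReal p) (volume.restrict (Ioi (0 : ℝ))) ∧
      (∀ n : ℕ, IntegrableOn (fun x => f x * laguerreFun α n x) (Ioi (0 : ℝ))) ∧
      (∀ᵐ x ∂(volume.restrict (Ioi (0 : ℝ))),
        ¬ ∃ l : ℝ, Tendsto (fun N : ℕ => cesaroMean δ (laguerreTerm α f x) N) atTop (𝓝 l)) ∧
      (∀ᵐ x ∂(volume.restrict (Ioi (0 : ℝ))),
        ¬ ∃ l : ℝ, Tendsto (fun r : ℝ => rieszMean δ (laguerreTerm α f x) r) atTop (𝓝 l)) := by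
  have hδ1 : δ < 1 := by
    have : 0 < 1 / p := by positivity
    linarith
  obtain ⟨f, hf, hint, hunb⟩ := exists_memLp_laguerreCoeff_unbounded (β := δ + 1 / 4) hα hp
    (by linarith) (by linarith)
  have hlarge : ∀ (C : ℝ) (N : ℕ), ∃ n ≥ N,
      C * (n + 1 : ℝ) ^ (δ + 1 / 4) < |laguerreCoeff α f n| := by
    intro C N
    -- the constant `D` accounts for the finitely many coefficients with `n < N`
    set D := ∑ m ∈ Finset.range N, |laguerreCoeff α f m| / (m + 1 : ℝ) ^ (δ + 1 / 4) with hD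
    obtain ⟨n, hn⟩ := hunb (|C| + D)
    have hD0 : 0 ≤ D := Finset.sum_nonneg fun m _ => by positivity
    have hpow : (0 : ℝ) < (n + 1 : ℝ) ^ (δ + 1 / 4) := by positivity
    refine ⟨n, ?_, lt_of_le_of_lt ?_ hn⟩
    · by_contra hnN
      have h1 : |laguerreCoeff α f n| / (n + 1 : ℝ) ^ (δ + 1 / 4) ≤ D :=
        Finset.single_le_sum
          (f := fun m : ℕ => |laguerreCoeff α f m| / (m + 1 : ℝ) ^ (δ + 1 / 4))
          (fun m _ => by positivity) (Finset.mem_range.mpr (not_le.mp hnN))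
      rw [div_le_iff₀ hpow] at h1
      nlinarith [abs_nonneg C]
    · exact mul_le_mul_of_nonneg_right (by linarith [le_abs_self C]) hpow.le
  have hae := ae_not_exists_abs_mul_laguerreFun_le (δ := δ) hα hlarge
  refine ⟨f, hf, hint, ?_, ?_⟩
  · filter_upwards [hae] with x hx
    rintro ⟨l, hl⟩
    exact hx (exists_abs_le_of_tendsto_cesaroMean hδ0 hδ1 hl)
  · filter_upwards [hae] with x hx
    rintro ⟨l, hl⟩
    exact hx (exists_abs_le_of_tendsto_rieszMean hδ0 hδ1 hl)
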